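/- Fix integers $p\ge 1$ and $n\ge 1$ and put $J=\begin{bmatrix}0&I_p\\ I_p&0\end{bmatrix}$. A block Hankel matrix is a matrix $H(n)=\{H_{i+j-2}\}_{i,j=1}^n$ with blocks $H_k\in\mathbb C^{p\times p}$ $(0\le k\le 2n-2)$; $H(n)>0$ means that it is Hermitian and positive definite. For $1\le m\le n$ let $H(m)=\{H_{i+j-2}\}_{i,j=1}^m$, $T(m)=H(m)^{-1}$, let $A(m)$ be the $mp\times mp$ block shift with blocks $I_p$ on the first block subdiagonal and zeros elsewhere, and let $$\Pi(m)=\begin{bmatrix}\Phi_1(m)&\Phi_2(m)\end{bmatrix},\quad \Phi_1(m)=-\mathrm i\begin{bmatrix}0\\H_0\\ \vdots\\H_{m-2}\end{bmatrix},\quad \Phi_2(m)=\begin{bmatrix}I_p\\0\\ \vdots\\0\end{bmatrix},\quad P_2(m)=\begin{bmatrix}0&\cdots&0&I_p\end{bmatrix}\in\mathbb C^{p\times mp}$$ (so $\Phi_1(1)=0$). The Verblunsky-type coefficients of $H(n)>0$ are the $p\times 2p$ matrices $\omega_k=P_2(k+1)T(k+1)\Pi(k+1)$, $0\le k<n$.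 **Theorem.** (a) The map $H(n)\mapsto(\omega_0,\dots,\omega_{n-1})$ is a bijection from the set of block Hankel matrices $H(n)>0$ onto the set of all sequences of $p\times 2p$ complex matrices $\omega_k$ $(0\le k<n)$ such that $$\omega_0\begin{bmatrix}I_p\\0\end{bmatrix}=0,\quad \omega_0\begin{bmatrix}0\\I_p\end{bmatrix}>0;\qquad \omega_kJ\omega_k^*=0,\quad \mathrm i\,\omega_kJ\omega_{k-1}^*>0\quad(0<k<n).$$ (b) The blocks of $H(n)>0$ are recovered successively from its Verblunsky-type coefficients, as follows. First, $H_0=\left(\omega_0\begin{bmatrix}0\\I_p\end{bmatrix}\right)^{-1}$. Next, let $0<r<n$. (i) The transfer matrix function $w_A(r+1,\lambda)=I_{2p}-\mathrm iJ\Pi(r+1)^*H(r+1)^{-1}\big(A(r+1)-\lambda I_{(r+1)p}\big)^{-1}\Pi(r+1)$ is determined by $\omega_0,\dots,\omega_r$: for $\lambda\neq0$, $$w_A(r+1,\lambda)=w_{r+1}(\lambda)w_r(\lambda)\cdots w_1(\lambda),\qquad w_{k+1}(\lambda)=I_{2p}+\frac{\mathrm i}{\lambda}JQ_k,$$ where $Q_0=\omega_0^*\left(\omega_0\begin{bmatrix}0\\I_p\end{bmatrix}\right)^{-1}\omega_0$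 and $Q_k=\omega_k^*(\mathrm i\,\omega_kJ\omega_{k-1}^*)^{-1}\omega_k$ for $k>0$. (ii) Put $\mathfrak A(z)=w_A(r+1,1/\overline z)^*$, $\mathfrak A_1=\begin{bmatrix}I_p&0\end{bmatrix}\mathfrak A$, $\mathfrak A_2=\begin{bmatrix}0&I_p\end{bmatrix}\mathfrak A$. Let $\mathcal Q$ be any $2p\times p$ matrix function that is holomorphic in the open upper half-plane $\mathbb C_+$ and satisfies $\mathcal Q(z)^*\mathcal Q(z)>0$ and $\mathcal Q(z)^*J\mathcal Q(z)\ge0$ there. Then $\mathfrak A_2(z)\mathcal Q(z)$ is invertible for all $z\in\mathbb C_+$, and $\varphi(z)=\mathrm i\,\mathfrak A_1(z)\mathcal Q(z)\big(\mathfrak A_2(z)\mathcal Q(z)\big)^{-1}$ has, for some $p\times p$ matrix $\breve H_{2r}$, the expansion $$\varphi(z)=-\sum_{k=0}^{2r-1}\frac{1}{z^{k+1}}H_k+\frac1{z^{2r+1}}\breve H_{2r}+o\!\left(\frac1{z^{2r+1}}\right)$$ as $z$ tends to infinity nontangentially in $\mathbb C_+$ (that is, in each sector $\{z:\Im z\ge\delta|z|\}$,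 $\delta>0$). The block $H_{2r-1}$ is uniquely recovered from this expansion: in every expansion $\varphi(z)=\sum_{k=0}^{2r}z^{-(k+1)}c_k+o(z^{-2r-1})$ of this kind one has $c_{2r-1}=-H_{2r-1}$. (iii) Finally, $$H_{2r}=(\mathrm i\,\omega_rJ\omega_{r-1}^*)^{-1}+\mathcal H_{12}^*\,T(r)\,\mathcal H_{12},\qquad \mathcal H_{12}=\begin{bmatrix}H_r\\ \vdots\\H_{2r-1}\end{bmatrix}.$$ -/

import Mathlib

open scoped Matrix ComplexOrder

noncomputable section

namespace HankelVerblunsky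

/-- Complex `p × p` matrices. -/
abbrev Blk (p : ℕ) := Matrix (Fin p) (Fin p) ℂ

/-- Complex `p × 2p` matrices; the columns are split into two groups of `p` columns. -/
abbrev Row (p : ℕ) := Matrix (Fin p) (Fin p ⊕ Fin p) ℂ

/-- Complex `2p × p` matrices. -/
abbrev Col (p : ℕ) := Matrix (Fin p ⊕ Fin p) (Fin p) ℂ

/-- Complex `2p × 2p` matrices. -/
abbrev Dbl (p : ℕ) := Matrix (Fin p ⊕ Fin p) (Fin p ⊕ Fin p) ℂ

/-- Complex `np × np` matrices, seen as `n × n` matrices of `p × p` blocks. -/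
abbrev BlockMat (n p : ℕ) := Matrix (Fin n × Fin p) (Fin n × Fin p) ℂ

/-- A block matrix is a block Hankel matrix if its blocks depend only on the sum of the indices. -/
def IsBlockHankel {n p : ℕ} (M : BlockMat n p) : Prop :=
  ∀ i j i' j' : Fin n, (i : ℕ) + j = (i' : ℕ) + j' →
    ∀ a b : Fin p, M (i, a) (j, b) = M (i', a) (j', b)

/-- The positive definite (in particular self-adjoint) `n × n` block Hankel matrices with
`p × p` blocks. -/
def posDefHankel (n p : ℕ) : Set (BlockMat n p) :=
  {M | IsBlockHankel M ∧ M.PosDef}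

/-- The block `H_k`, `0 ≤ k ≤ 2n - 2`, of an `n × n` block Hankel matrix, read off at the position
`(k / 2, k - k / 2)` (rows and columns of blocks are counted from `0`); it is set to `0` for other
values of `k`, which are never used. -/
def hankelBlock {n p : ℕ} (M : BlockMat n p) (k : ℕ) : Blk p :=
  if hk : k < 2 * n - 1 then
    Matrix.of fun a b => M (⟨k / 2, by omega⟩, a) (⟨k - k / 2, by omega⟩, b)
  else 0

/-- The block Hankel matrix `H(m) = {H_{i+j}}`, `0 ≤ i, j < m`. -/
def blockHankel {p : ℕ} (m : ℕ) (H : ℕ → Blk p) : BlockMat m p :=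
  Matrix.of fun x y => H ((x.1 : ℕ) + y.1) x.2 y.2

/-- The block shift `A(m)`, with `I_p` on the first block subdiagonal. -/
def shiftA (m p : ℕ) : BlockMat m p :=
  Matrix.of fun x y => if (x.1 : ℕ) = y.1 + 1 ∧ x.2 = y.2 then 1 else 0

/-- The `2p × 2p` matrix `J = [0, I; I, 0]`. -/
def matJ (p : ℕ) : Dbl p := Matrix.fromBlocks 0 1 1 0

/-- `Φ₁(m) = -i [0; H_0; H_1; …; H_{m-2}]`. -/
def Phi1 {p : ℕ} (m : ℕ) (H : ℕ → Blk p) : Matrix (Fin m × Fin p) (Fin p) ℂ :=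
  Matrix.of fun x b => if (x.1 : ℕ) = 0 then 0 else -Complex.I * H ((x.1 : ℕ) - 1) x.2 b

/-- `Φ₂(m) = [I; 0; …; 0]`. -/
def Phi2 (m p : ℕ) : Matrix (Fin m × Fin p) (Fin p) ℂ :=
  Matrix.of fun x b => if (x.1 : ℕ) = 0 ∧ x.2 = b then 1 else 0

/-- `Π(m) = [Φ₁(m), Φ₂(m)]`. -/
def matPi {p : ℕ} (m : ℕ) (H : ℕ → Blk p) : Matrix (Fin m × Fin p) (Fin p ⊕ Fin p) ℂ :=
  Matrix.fromCols (Phi1 m H) (Phi2 m p)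

/-- `P₂(m) = [0, …, 0, I]`. -/
def matP2 (m p : ℕ) : Matrix (Fin p) (Fin m × Fin p) ℂ :=
  Matrix.of fun a x => if (x.1 : ℕ) + 1 = m ∧ a = x.2 then 1 else 0

/-- `T(m) = H(m)⁻¹`. -/
def matT {p : ℕ} (m : ℕ) (H : ℕ → Blk p) : BlockMat m p := (blockHankel m H)⁻¹

/-- The Verblunsky-type coefficients `ω_k = P₂(k+1) T(k+1) Π(k+1)`. -/
def verblunsky {p : ℕ} (H : ℕ → Blk p) (k : ℕ) : Row p :=
  matP2 (k + 1) p * matT (k + 1) H * matPi (k + 1) H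

/-- `[I; 0]`. -/
def colTop (p : ℕ) : Col p := Matrix.fromRows 1 0

/-- `[0; I]`. -/
def colBot (p : ℕ) : Col p := Matrix.fromRows 0 1

/-- The conditions `ω_0 [I; 0] = 0`, `ω_0 [0; I] > 0` and `ω_k J ω_k^* = 0`,
`i ω_k J ω_{k-1}^* > 0` for `0 < k < n`. -/
def IsAdmissible {n p : ℕ} (ω : Fin n → Row p) : Prop :=
  (∀ k : Fin n, (k : ℕ) = 0 → ω k * colTop p = 0 ∧ (ω k * colBot p).PosDef) ∧
  (∀ k l : Fin n, (k : ℕ) = l + 1 →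
    ω k * matJ p * (ω k)ᴴ = 0 ∧ (Complex.I • (ω k * matJ p * (ω l)ᴴ)).PosDef)

/-- The last block column above the diagonal, `ℋ₁₂(r+1) = [H_r; …; H_{2r-1}]`. -/
def calH12 {p : ℕ} (r : ℕ) (H : ℕ → Blk p) : Matrix (Fin r × Fin p) (Fin p) ℂ :=
  Matrix.of fun x b => H (r + x.1) x.2 b

/-- The transfer matrix function
`w_A(m, z) = I - i J Π(m)^* H(m)⁻¹ (A(m) - z I)⁻¹ Π(m)`. -/
def transfer {p : ℕ} (m : ℕ) (H : ℕ → Blk p) (z : ℂ) : Dbl p :=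
  1 - Complex.I • (matJ p * (matPi m H)ᴴ * (blockHankel m H)⁻¹ *
    (shiftA m p - z • (1 : BlockMat m p))⁻¹ * matPi m H)

/-- `𝔄(m, z) = w_A(m, 1 / z̄)^*`. -/
def frakA {p : ℕ} (m : ℕ) (H : ℕ → Blk p) (z : ℂ) : Dbl p :=
  (transfer m H (1 / (starRingEnd ℂ) z))ᴴ

/-- `𝔄₁ = [I, 0] 𝔄`. -/
def frakA1 {p : ℕ} (m : ℕ) (H : ℕ → Blk p) (z : ℂ) : Row p :=
  (colTop p)ᴴ * frakA m H z

/-- `𝔄₂ = [0, I] 𝔄`. -/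
def frakA2 {p : ℕ} (m : ℕ) (H : ℕ → Blk p) (z : ℂ) : Row p :=
  (colBot p)ᴴ * frakA m H z

/-- The Hamiltonian expressed through the coefficients: `Q_0 = ω_0^* (ω_0 [0; I])⁻¹ ω_0` and
`Q_k = ω_k^* (i ω_k J ω_{k-1}^*)⁻¹ ω_k` for `k > 0`. -/
def hamiltonian {p : ℕ} (ω : ℕ → Row p) : ℕ → Dbl p
  | 0 => (ω 0)ᴴ * (ω 0 * colBot p)⁻¹ * ω 0
  | k + 1 =>
      (ω (k + 1))ᴴ * (Complex.I • (ω (k + 1) * matJ p * (ω k)ᴴ))⁻¹ * ω (k + 1)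

/-- The product `w_m(z) w_{m-1}(z) ⋯ w_1(z)`, `w_{k+1}(z) = I + (i / z) J Q_k`, of the factors of
the canonical system with the Hamiltonian given by `ω`. -/
def canonicalProduct {p : ℕ} (ω : ℕ → Row p) : ℕ → ℂ → Dbl p
  | 0, _ => 1
  | k + 1, z => (1 + (Complex.I / z) • (matJ p * hamiltonian ω k)) * canonicalProduct ω k z

/-- `2p × p` matrix functions that are holomorphic in the open upper half-plane and nonsingular with
property-`J` there. -/
def IsNonsingularPropertyJ {p : ℕ} (Q : ℂ → Col p) : Prop :=
  (∀ i j, DifferentiableOn ℂ (fun z => Q z i j) {z : ℂ | 0 < z.im}) ∧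
  ∀ z : ℂ, 0 < z.im → ((Q z)ᴴ * Q z).PosDef ∧ ((Q z)ᴴ * matJ p * Q z).PosSemidef

/-- The linear fractional transformation `φ_Q(z) = i 𝔄₁(m, z) Q(z) (𝔄₂(m, z) Q(z))⁻¹`. -/
def lft {p : ℕ} (m : ℕ) (H : ℕ → Blk p) (Q : ℂ → Col p) (z : ℂ) : Blk p :=
  Complex.I • (frakA1 m H z * Q z * (frakA2 m H z * Q z)⁻¹)

/-- `z → ∞` within the sector `{z : Im z ≥ δ |z|}` of the upper half-plane. -/
def sectorAtInfinity (δ : ℝ) : Filter ℂ :=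
  Bornology.cobounded ℂ ⊓ Filter.principal {z : ℂ | δ * ‖z‖ ≤ z.im}

/-- The asymptotic expansion `φ(z) = ∑_{k < N} z^{-(k+1)} c_k + o(z^{-N})` for `z` tending
nontangentially to infinity in the open upper half-plane. -/
def HasNontangentialExpansion {p : ℕ} (φ : ℂ → Blk p) (N : ℕ) (c : ℕ → Blk p) : Prop :=
  ∀ δ : ℝ, 0 < δ → ∀ a b : Fin p,
    (fun z : ℂ => φ z a b - ∑ k ∈ Finset.range N, (z ^ (k + 1))⁻¹ * c k a b)
      =o[sectorAtInfinity δ] fun z : ℂ => (z ^ N)⁻¹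

end HankelVerblunsky

end

open scoped Matrix ComplexOrder

noncomputable section

namespace HankelVerblunsky

variable {p : ℕ}

/-! The proof rests on two structures: the Schur complement of `H(r)` in `H(r+1)`, and the
displacement identity `A H - H A* = i Π J Π*`.

Let `t_r` (`lastBlk`) be the last diagonal block of `T(r+1)`. Then `t_r⁻¹ = H_{2r} - ℋ₁₂* T(r) ℋ₁₂`,
and `T(r+1)` is the embedded `T(r)` plus a term `T P₂* t_r⁻¹ P₂ T`. Since the shift kills the last
block, the displacement identity gives `ω_r J ω_r* = 0` and `i ω_{r+1} J ω_r* = t_{r+1}`. So the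
coefficients are admissible and know every `t_r`, which is (iii), and the added term multiplies
`w_A` by a single factor (`transfer_succ`), which is (i).

For the bijection, if two sequences agree through `H_{2l}`, their rows `t⁻¹ ω_{l+1}` differ by the
difference of the blocks `H_{2l+1}` times `ω_l` (`inv_lastBlk_mul_verblunsky_sub`). Injectivity
follows because `ω_l` has a right inverse. Surjectivity follows because two neutral rows with the
same pairing against `ω_l` differ by `X ω_l` with `X` Hermitian (`eq_mul_of_neutral`), and any
Hermitian odd block is allowed in an extension.

For (ii), the identity `𝔄* J 𝔄 = J + (2 Im z / |z|²) G* H G` makes `𝔄₂ Q` invertible and yields a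
Potapov-type matrix inequality for `φ`. With `g_0 = φ` and `g_{k+1} = z g_k + H_k`, the defect of
this inequality is multiplied by `|z|²` at each step (`defect_succ`), so it is still nonnegative at
level `r`. There it says that `h = x* g_{2r} x` has `Im h ≥ 0` and `Im z |h|² ≤ s Im h`.
Schwarz–Pick applied to `-1/(h - 1/z)` then shows that `z h(z)` has a nontangential limit
(`exists_tendsto_mul`). By polarisation `z g_{2r}` converges, and this is the expansion, because
`g_{2r} = z^{2r} (φ + ∑ H_j z^{-j-1})`. Expansions are unique, so `H_{2r-1}` is recovered. -/

/-- The block embedding of `ℂ^{rp}` onto the first `r` blocks of `ℂ^{(r+1)p}`. -/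
def emb (r p : ℕ) : Matrix (Fin (r + 1) × Fin p) (Fin r × Fin p) ℂ :=
  Matrix.of fun x y => if (x.1 : ℕ) = y.1 ∧ x.2 = y.2 then 1 else 0

/-! ### Block calculus: embedding, last block, shift -/

theorem conj_emb_mul_apply {r : ℕ} {ι : Type*} (M : Matrix (Fin (r + 1) × Fin p) ι ℂ)
    (y : Fin r × Fin p) (c : ι) : ((emb r p)ᴴ * M) y c = M (y.1.castSucc, y.2) c := by
  rw [Matrix.mul_apply, Finset.sum_eq_single (y.1.castSucc, y.2)]
  · simp [emb]
  · rintro ⟨i, a⟩ - h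
    have : ¬ ((i : ℕ) = y.1 ∧ a = y.2) := by
      rintro ⟨h1, h2⟩
      exact h (Prod.ext (Fin.ext h1) h2)
    simp [emb, this]
  · simp

theorem mul_emb_apply {r : ℕ} {ι : Type*} (M : Matrix ι (Fin (r + 1) × Fin p) ℂ)
    (c : ι) (y : Fin r × Fin p) : (M * emb r p) c y = M c (y.1.castSucc, y.2) := by
  have := conj_emb_mul_apply Mᴴ y c
  rw [← Matrix.conjTranspose_mul, Matrix.conjTranspose_apply, Matrix.conjTranspose_apply] at this
  exact star_injective this

theorem matP2_mul_apply {r : ℕ} {ι : Type*} (M : Matrix (Fin (r + 1) × Fin p) ι ℂ)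
    (a : Fin p) (c : ι) : (matP2 (r + 1) p * M) a c = M (Fin.last r, a) c := by
  rw [Matrix.mul_apply, Finset.sum_eq_single (Fin.last r, a)]
  · simp [matP2]
  · rintro ⟨i, b⟩ - h
    have : ¬ ((i : ℕ) = r ∧ a = b) := by
      rintro ⟨h1, h2⟩
      exact h (Prod.ext (Fin.ext h1) h2.symm)
    simp [matP2, this]
  · simp

theorem mul_conj_matP2_apply {r : ℕ} {ι : Type*} (M : Matrix ι (Fin (r + 1) × Fin p) ℂ)
    (c : ι) (a : Fin p) : (M * (matP2 (r + 1) p)ᴴ) c a = M c (Fin.last r, a) := by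
  have := matP2_mul_apply Mᴴ a c
  rw [← Matrix.conjTranspose_conjTranspose (matP2 (r + 1) p * Mᴴ),
    Matrix.conjTranspose_mul, Matrix.conjTranspose_conjTranspose,
    Matrix.conjTranspose_apply, Matrix.conjTranspose_apply] at this
  exact star_injective this

theorem shiftA_mul_apply {m : ℕ} {ι : Type*} (M : Matrix (Fin m × Fin p) ι ℂ)
    (x : Fin m × Fin p) (c : ι) : (shiftA m p * M) x c =
      if (x.1 : ℕ) = 0 then 0 else M (⟨(x.1 : ℕ) - 1, by omega⟩, x.2) c := by
  rw [Matrix.mul_apply]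
  split_ifs with h
  · refine Finset.sum_eq_zero fun y _ => ?_
    have : ¬ ((x.1 : ℕ) = y.1 + 1 ∧ x.2 = y.2) := by omega
    simp [shiftA, this]
  · rw [Finset.sum_eq_single (⟨(x.1 : ℕ) - 1, by omega⟩, x.2)]
    · have : (x.1 : ℕ) = (x.1 : ℕ) - 1 + 1 := by omega
      simp [shiftA, ← this]
    · rintro ⟨i, b⟩ - h'
      have : ¬ ((x.1 : ℕ) = i + 1 ∧ x.2 = b) := by
        rintro ⟨h1, h2⟩
        exact h' (Prod.ext (Fin.ext (by simp; omega)) h2.symm)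
      simp [shiftA, this]
    · simp

theorem mul_conj_shiftA_apply {m : ℕ} {ι : Type*} (M : Matrix ι (Fin m × Fin p) ℂ)
    (c : ι) (x : Fin m × Fin p) : (M * (shiftA m p)ᴴ) c x =
      if (x.1 : ℕ) = 0 then 0 else M c (⟨(x.1 : ℕ) - 1, by omega⟩, x.2) := by
  have := shiftA_mul_apply Mᴴ x c
  rw [← Matrix.conjTranspose_conjTranspose (shiftA m p * Mᴴ),
    Matrix.conjTranspose_mul, Matrix.conjTranspose_conjTranspose,
    Matrix.conjTranspose_apply] at this
  apply star_injective
  rw [this]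
  split_ifs <;> simp

theorem conj_emb_mul_emb (r p : ℕ) : (emb r p)ᴴ * emb r p = 1 := by
  ext x y
  rw [conj_emb_mul_apply]
  simp [emb, Matrix.one_apply, Prod.ext_iff, Fin.ext_iff]

theorem matP2_mul_conj (r p : ℕ) : matP2 (r + 1) p * (matP2 (r + 1) p)ᴴ = 1 := by
  ext x y
  rw [mul_conj_matP2_apply]
  simp [matP2, Matrix.one_apply]

theorem matP2_mul_emb (r p : ℕ) : matP2 (r + 1) p * emb r p = 0 := by
  ext x y
  rw [mul_emb_apply]
  have : (y.1 : ℕ) ≠ r := by omega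
  simp [matP2, this]

theorem conj_emb_mul_conj_matP2 (r p : ℕ) : (emb r p)ᴴ * (matP2 (r + 1) p)ᴴ = 0 := by
  rw [← Matrix.conjTranspose_mul, matP2_mul_emb, Matrix.conjTranspose_zero]

theorem emb_mul_add (r p : ℕ) :
    emb r p * (emb r p)ᴴ + (matP2 (r + 1) p)ᴴ * matP2 (r + 1) p = 1 := by
  ext ⟨i, a⟩ y
  induction i using Fin.lastCases with
  | last =>
    have h1 : (emb r p * (emb r p)ᴴ) (Fin.last r, a) y = 0 := by
      have := matP2_mul_apply (emb r p * (emb r p)ᴴ) a y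
      rw [← this, ← Matrix.mul_assoc, matP2_mul_emb]; simp
    have h2 : ((matP2 (r + 1) p)ᴴ * matP2 (r + 1) p) (Fin.last r, a) y = matP2 (r + 1) p a y := by
      have := matP2_mul_apply ((matP2 (r + 1) p)ᴴ * matP2 (r + 1) p) a y
      rw [← this, ← Matrix.mul_assoc, matP2_mul_conj, Matrix.one_mul]
    rw [Matrix.add_apply, h1, h2, zero_add]
    simp only [matP2, Matrix.of_apply, Matrix.one_apply, Prod.ext_iff, Fin.ext_iff, Fin.val_last]
    congr 1
    simp; intro _; omega
  | cast i =>
    have h1 : (emb r p * (emb r p)ᴴ) (i.castSucc, a) y = (emb r p)ᴴ (i, a) y := by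
      have := conj_emb_mul_apply (emb r p * (emb r p)ᴴ) (i, a) y
      rw [← this, ← Matrix.mul_assoc, conj_emb_mul_emb, Matrix.one_mul]
    have h2 : ((matP2 (r + 1) p)ᴴ * matP2 (r + 1) p) (i.castSucc, a) y = 0 := by
      have := conj_emb_mul_apply ((matP2 (r + 1) p)ᴴ * matP2 (r + 1) p) (i, a) y
      rw [← this, ← Matrix.mul_assoc, conj_emb_mul_conj_matP2]; simp
    rw [Matrix.add_apply, h1, h2, add_zero]
    simp only [emb, Matrix.conjTranspose_apply, Matrix.of_apply, Matrix.one_apply, Prod.ext_iff,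
      Fin.ext_iff, Fin.val_castSucc]
    split_ifs <;> simp <;> omega

theorem emb_blockHankel_emb (r : ℕ) (H : ℕ → Blk p) :
    (emb r p)ᴴ * blockHankel (r + 1) H * emb r p = blockHankel r H := by
  ext x y
  rw [mul_emb_apply, conj_emb_mul_apply]
  simp [blockHankel]

theorem emb_blockHankel_matP2 (r : ℕ) (H : ℕ → Blk p) :
    (emb r p)ᴴ * blockHankel (r + 1) H * (matP2 (r + 1) p)ᴴ = calH12 r H := by
  ext x y
  rw [mul_conj_matP2_apply, conj_emb_mul_apply]
  simp [blockHankel, calH12, add_comm]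

theorem matP2_blockHankel_matP2 (r : ℕ) (H : ℕ → Blk p) :
    matP2 (r + 1) p * blockHankel (r + 1) H * (matP2 (r + 1) p)ᴴ = H (2 * r) := by
  ext x y
  rw [mul_conj_matP2_apply, matP2_mul_apply]
  simp [blockHankel, two_mul]

theorem emb_matPi (r : ℕ) (H : ℕ → Blk p) :
    (emb r p)ᴴ * matPi (r + 1) H = matPi r H := by
  ext x y
  rw [conj_emb_mul_apply]
  cases y <;> rfl

theorem emb_shiftA (r p : ℕ) : (emb r p)ᴴ * shiftA (r + 1) p = shiftA r p * (emb r p)ᴴ := by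
  ext x y
  rw [conj_emb_mul_apply, shiftA_mul_apply]
  simp only [shiftA, emb, Matrix.conjTranspose_apply, Matrix.of_apply, Fin.val_castSucc]
  split_ifs <;> simp <;> omega

theorem shiftA_mul_conj_matP2 (r p : ℕ) : shiftA (r + 1) p * (matP2 (r + 1) p)ᴴ = 0 := by
  ext x y
  rw [mul_conj_matP2_apply]
  have : (x.1 : ℕ) ≠ r + 1 := by omega
  simp [shiftA, this]

theorem matP2_mul_conj_shiftA (r p : ℕ) : matP2 (r + 1) p * (shiftA (r + 1) p)ᴴ = 0 := by
  have := congrArg Matrix.conjTranspose (shiftA_mul_conj_matP2 r p)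
  simpa using this

theorem shiftA_emb_matP2 (l p : ℕ) :
    shiftA (l + 2) p * (emb (l + 1) p * (matP2 (l + 1) p)ᴴ) = (matP2 (l + 2) p)ᴴ := by
  ext x y
  rw [← Matrix.mul_assoc, mul_conj_matP2_apply, mul_emb_apply]
  simp only [shiftA, matP2, Matrix.conjTranspose_apply, Matrix.of_apply, Fin.val_castSucc,
    Fin.val_last, Fin.ext_iff]
  split_ifs <;> simp <;> grind

theorem matP2_matPi (l : ℕ) (H : ℕ → Blk p) :
    matP2 (l + 2) p * matPi (l + 2) H = Matrix.fromCols (-Complex.I • H l) 0 := by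
  ext x y
  rw [matP2_mul_apply]
  cases y <;> simp [matPi, Phi1, Phi2]

/-- Shifting a Hankel array down or to the right gives the same entries away from the first block
row and column, so only a border survives. Hermitian blocks make its top row the adjoint of its left
column. -/
theorem displacement (m : ℕ) (H : ℕ → Blk p) (hH : ∀ k, k + 1 < m → (H k)ᴴ = H k) :
    shiftA m p * blockHankel m H - blockHankel m H * (shiftA m p)ᴴ =
      Complex.I • (matPi m H * matJ p * (matPi m H)ᴴ) := by
  have h : matPi m H * matJ p * (matPi m H)ᴴ =
      Phi1 m H * (Phi2 m p)ᴴ + Phi2 m p * (Phi1 m H)ᴴ := by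
    rw [matPi, matJ, Matrix.fromCols_mul_fromBlocks,
      Matrix.conjTranspose_fromCols_eq_fromRows_conjTranspose, Matrix.fromCols_mul_fromRows]
    simp [add_comm]
  have h2 : ∀ (M : Matrix (Fin m × Fin p) (Fin p) ℂ) x y, (M * (Phi2 m p)ᴴ) x y =
      if (y.1 : ℕ) = 0 then M x y.2 else 0 := by
    intro M x y
    rw [Matrix.mul_apply]
    split_ifs with hy
    · simp [Phi2, hy]
    · simp [Phi2, hy]
  have h3 : ∀ (M : Matrix (Fin p) (Fin m × Fin p) ℂ) x y, (Phi2 m p * M) x y =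
      if (x.1 : ℕ) = 0 then M x.2 y else 0 := by
    intro M x y
    rw [Matrix.mul_apply]
    split_ifs with hy
    · simp [Phi2, hy]
    · simp [Phi2, hy]
  rw [h]
  ext x y
  rw [Matrix.sub_apply, shiftA_mul_apply, mul_conj_shiftA_apply, Matrix.smul_apply,
    Matrix.add_apply, h2, h3]
  by_cases hx : (x.1 : ℕ) = 0 <;> by_cases hy : (y.1 : ℕ) = 0
  · simp [hx, hy, Phi1]
  · have := congrFun (congrFun (hH ((y.1 : ℕ) - 1) (by omega)) x.2) y.2
    rw [Matrix.conjTranspose_apply] at this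
    simp only [hx, hy, Phi1, blockHankel, if_true, if_false, Matrix.of_apply,
      Matrix.conjTranspose_apply, smul_eq_mul, zero_add, star_mul', star_neg, this]
    simp [← mul_assoc]
  · simp only [hx, hy, Phi1, blockHankel, if_true, if_false, Matrix.of_apply,
      smul_eq_mul, add_zero]
    simp [← mul_assoc]
  · have : (x.1 : ℕ) - 1 + y.1 = x.1 + (y.1 - 1) := by omega
    simp [hx, hy, blockHankel, this]

/-! ### Schur complements and the inverse of `H(r+1)` -/

theorem blockHankel_mul_matT {m : ℕ} {H : ℕ → Blk p} (h : (blockHankel m H).PosDef) :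
    blockHankel m H * matT m H = 1 :=
  Matrix.mul_nonsing_inv _ ((Matrix.isUnit_iff_isUnit_det _).1 h.isUnit)

theorem matT_mul_blockHankel {m : ℕ} {H : ℕ → Blk p} (h : (blockHankel m H).PosDef) :
    matT m H * blockHankel m H = 1 :=
  Matrix.nonsing_inv_mul _ ((Matrix.isUnit_iff_isUnit_det _).1 h.isUnit)

theorem matT_posDef {m : ℕ} {H : ℕ → Blk p} (h : (blockHankel m H).PosDef) :
    (matT m H).PosDef := h.inv

theorem blockHankel_posDef_pred {r : ℕ} {H : ℕ → Blk p} (h : (blockHankel (r + 1) H).PosDef) :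
    (blockHankel r H).PosDef := by
  rw [← emb_blockHankel_emb]
  refine h.conjTranspose_mul_mul_same fun x y hxy => ?_
  have := congrArg (fun v => (emb r p)ᴴ.mulVec v) hxy
  simpa [Matrix.mulVec_mulVec, conj_emb_mul_emb] using this

theorem blockHankel_posDef_mono {m n : ℕ} (hmn : m ≤ n) {H : ℕ → Blk p}
    (h : (blockHankel n H).PosDef) : (blockHankel m H).PosDef := by
  induction n, hmn using Nat.le_induction with
  | base => exact h
  | succ n _ ih => exact ih (blockHankel_posDef_pred h)

theorem conjTranspose_of_posDef {m : ℕ} {H : ℕ → Blk p} (h : (blockHankel m H).PosDef) {k : ℕ}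
    (hk : k + 1 < 2 * m) : (H k)ᴴ = H k := by
  ext a b
  have := h.isHermitian.apply (⟨k / 2, by omega⟩, a) (⟨k - k / 2, by omega⟩, b)
  simp only [blockHankel, Matrix.of_apply] at this
  rw [show k - k / 2 + k / 2 = k by omega, show k / 2 + (k - k / 2) = k by omega] at this
  simpa using this

/-- The last block row of the inverse, normalised to have the identity as its last block. -/
def schurRow (r : ℕ) (H : ℕ → Blk p) : Matrix (Fin p) (Fin (r + 1) × Fin p) ℂ :=
  matP2 (r + 1) p - (calH12 r H)ᴴ * matT r H * (emb r p)ᴴ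

/-- The last diagonal block of the inverse `T(r + 1)`. -/
def lastBlk (r : ℕ) (H : ℕ → Blk p) : Blk p :=
  matP2 (r + 1) p * matT (r + 1) H * (matP2 (r + 1) p)ᴴ

theorem matP2_blockHankel_emb {r : ℕ} {H : ℕ → Blk p} (h : (blockHankel (r + 1) H).IsHermitian) :
    matP2 (r + 1) p * blockHankel (r + 1) H * emb r p = (calH12 r H)ᴴ := by
  rw [← emb_blockHankel_matP2]
  simp [Matrix.conjTranspose_mul, h.eq, Matrix.mul_assoc]

theorem eq_emb_add {r : ℕ} {ι : Type*} (M : Matrix (Fin (r + 1) × Fin p) ι ℂ) :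
    M = emb r p * ((emb r p)ᴴ * M) + (matP2 (r + 1) p)ᴴ * (matP2 (r + 1) p * M) := by
  rw [← Matrix.mul_assoc, ← Matrix.mul_assoc, ← Matrix.add_mul, emb_mul_add, Matrix.one_mul]

/-- Multiplied by `H(r+1)`, the embedded `T(r)` agrees with the identity except in the last block
row, where the discrepancy is `schurRow`. -/
theorem matT_sub {r : ℕ} {H : ℕ → Blk p} (h : (blockHankel (r + 1) H).PosDef) :
    matT (r + 1) H - emb r p * matT r H * (emb r p)ᴴ =
      matT (r + 1) H * (matP2 (r + 1) p)ᴴ * schurRow r H := by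
  have h1 : blockHankel (r + 1) H * (matT (r + 1) H - emb r p * matT r H * (emb r p)ᴴ) =
      (matP2 (r + 1) p)ᴴ * schurRow r H := by
    rw [eq_emb_add (blockHankel (r + 1) H * _), Matrix.mul_sub, blockHankel_mul_matT h]
    have e1 : (emb r p)ᴴ * (1 - blockHankel (r + 1) H * (emb r p * matT r H * (emb r p)ᴴ)) = 0 := by
      rw [Matrix.mul_sub, Matrix.mul_one, ← Matrix.mul_assoc, ← Matrix.mul_assoc,
        ← Matrix.mul_assoc, emb_blockHankel_emb, blockHankel_mul_matT (blockHankel_posDef_pred h),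
        Matrix.one_mul, sub_self]
    have e2 : matP2 (r + 1) p * (1 - blockHankel (r + 1) H * (emb r p * matT r H * (emb r p)ᴴ))
        = schurRow r H := by
      rw [Matrix.mul_sub, Matrix.mul_one, ← Matrix.mul_assoc, ← Matrix.mul_assoc,
        ← Matrix.mul_assoc, matP2_blockHankel_emb h.isHermitian, schurRow]
    rw [e1, e2, Matrix.mul_zero, zero_add]
  rw [Matrix.mul_assoc (matT _ _), ← h1, ← Matrix.mul_assoc, matT_mul_blockHankel h, Matrix.one_mul]

theorem lastBlk_mul_schurRow {r : ℕ} {H : ℕ → Blk p} (h : (blockHankel (r + 1) H).PosDef) :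
    lastBlk r H * schurRow r H = matP2 (r + 1) p * matT (r + 1) H := by
  rw [lastBlk, Matrix.mul_assoc, Matrix.mul_assoc, ← Matrix.mul_assoc (matT (r + 1) H),
    ← matT_sub h, Matrix.mul_sub, Matrix.mul_assoc, ← Matrix.mul_assoc _ (emb r p), matP2_mul_emb,
    Matrix.zero_mul, sub_zero]

theorem schurRow_mul (r : ℕ) (H : ℕ → Blk p) :
    schurRow r H * (blockHankel (r + 1) H * (matP2 (r + 1) p)ᴴ) =
      H (2 * r) - (calH12 r H)ᴴ * matT r H * calH12 r H := by
  rw [schurRow, Matrix.sub_mul, ← Matrix.mul_assoc, matP2_blockHankel_matP2, Matrix.mul_assoc,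
    ← Matrix.mul_assoc (emb r p)ᴴ, emb_blockHankel_matP2]

theorem lastBlk_mul {r : ℕ} {H : ℕ → Blk p} (h : (blockHankel (r + 1) H).PosDef) :
    lastBlk r H * (H (2 * r) - (calH12 r H)ᴴ * matT r H * calH12 r H) = 1 := by
  rw [← schurRow_mul, ← Matrix.mul_assoc, lastBlk_mul_schurRow h, Matrix.mul_assoc,
    ← Matrix.mul_assoc (matT _ _), matT_mul_blockHankel h, Matrix.one_mul, matP2_mul_conj]

theorem inv_lastBlk {r : ℕ} {H : ℕ → Blk p} (h : (blockHankel (r + 1) H).PosDef) :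
    (lastBlk r H)⁻¹ = H (2 * r) - (calH12 r H)ᴴ * matT r H * calH12 r H :=
  Matrix.inv_eq_right_inv (lastBlk_mul h)

theorem lastBlk_posDef {r : ℕ} {H : ℕ → Blk p} (h : (blockHankel (r + 1) H).PosDef) :
    (lastBlk r H).PosDef := by
  have := (matT_posDef h).conjTranspose_mul_mul_same (B := (matP2 (r + 1) p)ᴴ)
    fun x y hxy => by
      have := congrArg (fun v => (matP2 (r + 1) p).mulVec v) hxy
      simpa [Matrix.mulVec_mulVec, matP2_mul_conj] using this
  rwa [Matrix.conjTranspose_conjTranspose] at this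

/-- The block `H_{2r}` has disappeared from the right side. This makes `t_r⁻¹ ω_r` the right
quantity for isolating the effect of the odd block `H_{2r-1}`. -/
theorem inv_lastBlk_mul_verblunsky {r : ℕ} {H : ℕ → Blk p} (h : (blockHankel (r + 1) H).PosDef) :
    (lastBlk r H)⁻¹ * verblunsky H r =
      matP2 (r + 1) p * matPi (r + 1) H - (calH12 r H)ᴴ * matT r H * matPi r H := by
  rw [verblunsky, ← lastBlk_mul_schurRow h, Matrix.mul_assoc, ← Matrix.mul_assoc,
    Matrix.nonsing_inv_mul _ ((Matrix.isUnit_iff_isUnit_det _).1 (lastBlk_posDef h).isUnit),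
    Matrix.one_mul, schurRow, Matrix.sub_mul, Matrix.mul_assoc _ (emb r p)ᴴ, emb_matPi]

theorem schurRow_eq {r : ℕ} {H : ℕ → Blk p} (h : (blockHankel (r + 1) H).PosDef) :
    schurRow r H = (lastBlk r H)⁻¹ * (matP2 (r + 1) p * matT (r + 1) H) := by
  rw [← lastBlk_mul_schurRow h, ← Matrix.mul_assoc,
    Matrix.nonsing_inv_mul _ ((Matrix.isUnit_iff_isUnit_det _).1 (lastBlk_posDef h).isUnit),
    Matrix.one_mul]

/-! ### Relations between consecutive coefficients -/

theorem conj_verblunsky {r : ℕ} {H : ℕ → Blk p} (h : (blockHankel (r + 1) H).PosDef) :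
    (verblunsky H r)ᴴ =
      (matPi (r + 1) H)ᴴ * (matT (r + 1) H * (matP2 (r + 1) p)ᴴ) := by
  simp [verblunsky, Matrix.conjTranspose_mul, (matT_posDef h).isHermitian.eq]

/-- `i ω_r J Π* = P₂ T (A S - S A*) = P₂ T A S`. -/
theorem verblunsky_mul_conj_matPi {r : ℕ} {H : ℕ → Blk p} (h : (blockHankel (r + 1) H).PosDef) :
    Complex.I • (verblunsky H r * matJ p * (matPi (r + 1) H)ᴴ) =
      matP2 (r + 1) p * matT (r + 1) H * shiftA (r + 1) p * blockHankel (r + 1) H := by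
  have := displacement (r + 1) H fun k hk => conjTranspose_of_posDef h (by omega)
  rw [verblunsky, Matrix.mul_assoc _ (matPi _ _), Matrix.mul_assoc _ (_ * _), ← Matrix.mul_smul,
    ← this, Matrix.mul_sub, Matrix.mul_assoc _ _ (_ * (shiftA _ _)ᴴ),
      ← Matrix.mul_assoc (matT _ _) (blockHankel _ _),
    matT_mul_blockHankel h, Matrix.one_mul, matP2_mul_conj_shiftA, sub_zero]
  simp only [Matrix.mul_assoc]

theorem verblunsky_neutral {r : ℕ} {H : ℕ → Blk p} (h : (blockHankel (r + 1) H).PosDef) :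
    verblunsky H r * matJ p * (verblunsky H r)ᴴ = 0 := by
  have := verblunsky_mul_conj_matPi h
  have h2 : Complex.I • (verblunsky H r * matJ p * (verblunsky H r)ᴴ) = 0 := by
    rw [conj_verblunsky h, ← Matrix.mul_assoc _ (matPi _ _)ᴴ, ← Matrix.smul_mul, this,
      Matrix.mul_assoc _ (blockHankel _ _), ← Matrix.mul_assoc (blockHankel _ _),
      blockHankel_mul_matT h, Matrix.one_mul, Matrix.mul_assoc, shiftA_mul_conj_matP2,
      Matrix.mul_zero]
  exact (smul_eq_zero.1 h2).resolve_left Complex.I_ne_zero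

theorem emb_matT_emb {r : ℕ} {H : ℕ → Blk p} (h : (blockHankel (r + 1) H).PosDef) :
    emb r p * matT r H * (emb r p)ᴴ = matT (r + 1) H -
      matT (r + 1) H * (matP2 (r + 1) p)ᴴ * schurRow r H := by
  rw [← matT_sub h, sub_sub_cancel]

/-- The product of `H(r+1)` with the embedded `T(r)` differs from the identity by a matrix with
range in the last block, and the shift annihilates that block. -/
theorem shiftA_mul_emb_matT {r : ℕ} {H : ℕ → Blk p} (h : (blockHankel (r + 1) H).PosDef) :
    shiftA (r + 1) p * (blockHankel (r + 1) H * (emb r p * matT r H * (emb r p)ᴴ)) =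
      shiftA (r + 1) p := by
  rw [emb_matT_emb h, Matrix.mul_sub, blockHankel_mul_matT h, ← Matrix.mul_assoc (blockHankel _ _),
    ← Matrix.mul_assoc (blockHankel _ _), blockHankel_mul_matT h, Matrix.one_mul, Matrix.mul_sub,
    ← Matrix.mul_assoc, shiftA_mul_conj_matP2, Matrix.zero_mul, Matrix.mul_one, sub_zero]

/-- Written through the embedding, `ω_l*` ends in the next-to-last unit block column. The shift
moves it to the last one, leaving `P₂ T P₂*`. -/
theorem verblunsky_mul_conj_pred {l : ℕ} {H : ℕ → Blk p} (h : (blockHankel (l + 2) H).PosDef) :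
    Complex.I • (verblunsky H (l + 1) * matJ p * (verblunsky H l)ᴴ) = lastBlk (l + 1) H := by
  rw [conj_verblunsky (blockHankel_posDef_pred h), ← emb_matPi (l + 1), Matrix.conjTranspose_mul,
    Matrix.conjTranspose_conjTranspose]
  have h0 : verblunsky H (l + 1) * matJ p *
      ((matPi (l + 1 + 1) H)ᴴ * emb (l + 1) p * (matT (l + 1) H * (matP2 (l + 1) p)ᴴ)) =
      verblunsky H (l + 1) * matJ p * (matPi (l + 1 + 1) H)ᴴ *
        (emb (l + 1) p * (matT (l + 1) H * (matP2 (l + 1) p)ᴴ)) := by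
    simp only [Matrix.mul_assoc]
  have h1 : emb (l + 1) p * (matT (l + 1) H * (matP2 (l + 1) p)ᴴ) =
      (emb (l + 1) p * matT (l + 1) H * (emb (l + 1) p)ᴴ) *
        (emb (l + 1) p * (matP2 (l + 1) p)ᴴ) := by
    rw [Matrix.mul_assoc _ (emb _ _)ᴴ, ← Matrix.mul_assoc (emb _ _)ᴴ, conj_emb_mul_emb,
      Matrix.one_mul, Matrix.mul_assoc]
  rw [h0, ← Matrix.smul_mul, verblunsky_mul_conj_matPi h, h1, Matrix.mul_assoc _ (blockHankel _ _),
    ← Matrix.mul_assoc (blockHankel _ _), Matrix.mul_assoc _ (shiftA _ _),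
    ← Matrix.mul_assoc (shiftA _ _),
    shiftA_mul_emb_matT h, shiftA_emb_matP2, lastBlk]

theorem verblunsky_zero_colBot (H : ℕ → Blk p) : verblunsky H 0 * colBot p = lastBlk 0 H := by
  have : matPi 1 H * colBot p = (matP2 1 p)ᴴ := by
    rw [matPi, colBot, Matrix.fromCols_mul_fromRows, Matrix.mul_zero, Matrix.mul_one, zero_add]
    ext x y
    simp [Phi2, matP2, eq_comm]
  rw [verblunsky, Matrix.mul_assoc, this, lastBlk]

theorem verblunsky_zero_colTop (H : ℕ → Blk p) : verblunsky H 0 * colTop p = 0 := by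
  have : matPi 1 H * colTop p = 0 := by
    rw [matPi, colTop, Matrix.fromCols_mul_fromRows, Matrix.mul_zero, Matrix.mul_one, add_zero]
    ext x y
    have : (x.1 : ℕ) = 0 := by omega
    simp [Phi1]
  rw [verblunsky, Matrix.mul_assoc, this, Matrix.mul_zero]

/-! ### Factorization of the transfer function -/

theorem isUnit_det_shiftA_sub (m : ℕ) {z : ℂ} (hz : z ≠ 0) :
    IsUnit (shiftA m p - z • (1 : BlockMat m p)).det := by
  rw [← Matrix.isUnit_iff_isUnit_det, ← Matrix.mulVec_injective_iff_isUnit]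
  refine (injective_iff_map_eq_zero (Matrix.mulVecLin _)).2 fun v hv => ?_
  rw [Matrix.mulVecLin_apply, Matrix.sub_mulVec, Matrix.smul_mulVec, Matrix.one_mulVec] at hv
  have key : ∀ x : Fin m × Fin p, z * v x =
      if (x.1 : ℕ) = 0 then 0 else v (⟨(x.1 : ℕ) - 1, by omega⟩, x.2) := by
    intro x
    have h1 := congrFun hv x
    have h2 := shiftA_mul_apply (Matrix.replicateCol Unit v) x ()
    rw [Matrix.replicateCol_apply] at h2
    have h3 : (shiftA m p).mulVec v x = (shiftA m p * Matrix.replicateCol Unit v) x () := by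
      simp [Matrix.mulVec, Matrix.mul_apply, dotProduct]
    rw [← h2, ← h3]
    simp only [Pi.sub_apply, Pi.smul_apply, smul_eq_mul, Pi.zero_apply] at h1
    exact (sub_eq_zero.1 h1).symm
  have main : ∀ k : ℕ, ∀ x : Fin m × Fin p, (x.1 : ℕ) = k → v x = 0 := by
    intro k
    induction k with
    | zero =>
      intro x hx
      have := key x
      rw [if_pos hx] at this
      exact (mul_eq_zero.1 this).resolve_left hz
    | succ k ih =>
      intro x hx
      have := key x
      have h0 : v (⟨(x.1 : ℕ) - 1, by omega⟩, x.2) = 0 := ih _ (by simp [hx])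
      rw [if_neg (by omega), h0] at this
      exact (mul_eq_zero.1 this).resolve_left hz
  ext x
  exact main _ x rfl

/-- The shift is block lower triangular, so truncation to the first `r` blocks intertwines the two
shifts and hence their resolvents. -/
theorem emb_inv_shiftA_sub (r : ℕ) {z : ℂ} (hz : z ≠ 0) :
    (shiftA r p - z • (1 : BlockMat r p))⁻¹ * (emb r p)ᴴ =
      (emb r p)ᴴ * (shiftA (r + 1) p - z • (1 : BlockMat (r + 1) p))⁻¹ := by
  have h1 : (emb r p)ᴴ * (shiftA (r + 1) p - z • (1 : BlockMat (r + 1) p)) =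
      (shiftA r p - z • (1 : BlockMat r p)) * (emb r p)ᴴ := by
    rw [Matrix.mul_sub, Matrix.sub_mul, emb_shiftA]
    simp
  calc _ = (shiftA r p - z • (1 : BlockMat r p))⁻¹ * (emb r p)ᴴ *
        ((shiftA (r + 1) p - z • (1 : BlockMat (r + 1) p)) *
          (shiftA (r + 1) p - z • (1 : BlockMat (r + 1) p))⁻¹) := by
        rw [Matrix.mul_nonsing_inv _ (isUnit_det_shiftA_sub (r + 1) hz), Matrix.mul_one]
    _ = _ := by
        rw [← Matrix.mul_assoc, Matrix.mul_assoc _ (emb r p)ᴴ, h1, ← Matrix.mul_assoc,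
          Matrix.nonsing_inv_mul _ (isUnit_det_shiftA_sub r hz), Matrix.one_mul]

theorem transfer_succ {r : ℕ} {H : ℕ → Blk p} (h : (blockHankel (r + 1) H).PosDef) {z : ℂ}
    (hz : z ≠ 0) :
    transfer (r + 1) H z =
      (1 + (Complex.I / z) • (matJ p * ((verblunsky H r)ᴴ * (lastBlk r H)⁻¹ * verblunsky H r))) *
        transfer r H z := by
  set S := blockHankel (r + 1) H
  set X := (shiftA (r + 1) p - z • (1 : BlockMat (r + 1) p))⁻¹ with hX
  set P := matPi (r + 1) H
  set ω := verblunsky H r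
  set J := matJ p
  set T' := emb r p * matT r H * (emb r p)ᴴ with hT'
  have hred : transfer r H z = 1 - Complex.I • (J * Pᴴ * (T' * X * P)) := by
    rw [transfer, ← emb_matPi, Matrix.conjTranspose_mul, Matrix.conjTranspose_conjTranspose]
    have := emb_inv_shiftA_sub r (p := p) hz
    rw [← hX] at this
    congr 2
    change J * (Pᴴ * emb r p) * matT r H * _ * _ = _
    rw [Matrix.mul_assoc _ _ (_ * _), ← Matrix.mul_assoc _ (emb r p)ᴴ, this, hT']
    simp only [Matrix.mul_assoc]
    rfl
  have hAX : shiftA (r + 1) p * X = 1 + z • X := by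
    have := Matrix.mul_nonsing_inv _ (isUnit_det_shiftA_sub (r + 1) (p := p) hz)
    rw [← hX, Matrix.sub_mul, Matrix.smul_mul, Matrix.one_mul, sub_eq_iff_eq_add] at this
    exact this
  -- The increment of `w_A` contains `P₂ T X Π`; this identity recognises it as `ω_r` times the
  -- previous transfer function, which is what turns the sum into a product.
  have hω : ω * transfer r H z = -(z • (matP2 (r + 1) p * matT (r + 1) H * X * P)) := by
    have e : ω * (J * Pᴴ * (T' * X * P)) = ω * J * Pᴴ * (T' * X * P) := by
      simp only [Matrix.mul_assoc]
    rw [hred, Matrix.mul_sub, Matrix.mul_one, Matrix.mul_smul, e, ← Matrix.smul_mul,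
      verblunsky_mul_conj_matPi h,
      Matrix.mul_assoc _ (blockHankel _ _), Matrix.mul_assoc T', ← Matrix.mul_assoc _ T',
      Matrix.mul_assoc _ (shiftA _ _), ← Matrix.mul_assoc (shiftA _ _), shiftA_mul_emb_matT h,
      ← Matrix.mul_assoc _ X, hAX, Matrix.add_mul, Matrix.mul_add, Matrix.one_mul,
      Matrix.smul_mul, Matrix.mul_smul]
    simp only [ω, verblunsky, Matrix.mul_assoc]
    abel
  have hT : matT (r + 1) H = T' + matT (r + 1) H * (matP2 (r + 1) p)ᴴ *
      ((lastBlk r H)⁻¹ * (matP2 (r + 1) p * matT (r + 1) H)) := by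
    rw [hT', emb_matT_emb h, schurRow_eq h, sub_add_cancel]
  rw [Matrix.add_mul, Matrix.one_mul, Matrix.smul_mul, Matrix.mul_assoc J, Matrix.mul_assoc _ ω, hω,
    hred, conj_verblunsky h]
  have hl : transfer (r + 1) H z = 1 - Complex.I • (J * Pᴴ * (matT (r + 1) H * X * P)) := by
    simp only [transfer, Matrix.mul_assoc]; rfl
  rw [hl]
  conv_lhs => rw [hT]
  simp only [Matrix.mul_neg, Matrix.mul_smul, smul_neg, smul_smul, div_mul_cancel₀ _ hz,
    Matrix.add_mul, Matrix.mul_add, smul_add, Matrix.mul_assoc]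
  abel

theorem hamiltonian_verblunsky {n r : ℕ} {H : ℕ → Blk p} (h : (blockHankel n H).PosDef)
    (hr : r < n) : hamiltonian (verblunsky H) r =
      (verblunsky H r)ᴴ * (lastBlk r H)⁻¹ * verblunsky H r := by
  cases r with
  | zero => rw [hamiltonian, verblunsky_zero_colBot]
  | succ r => rw [hamiltonian, verblunsky_mul_conj_pred (blockHankel_posDef_mono hr h)]

theorem transfer_eq_canonicalProduct {m : ℕ} {H : ℕ → Blk p} (h : (blockHankel m H).PosDef) {z : ℂ}
    (hz : z ≠ 0) : transfer m H z = canonicalProduct (verblunsky H) m z := by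
  induction m with
  | zero =>
    ext i j
    simp [transfer, canonicalProduct, Matrix.mul_apply]
  | succ m ih =>
    rw [transfer_succ h hz, ih (blockHankel_posDef_pred h), canonicalProduct,
      hamiltonian_verblunsky h m.lt_succ_self]

/-! ### Positivity of an extension, and the bijection -/

theorem blockHankel_isHermitian {m : ℕ} {H : ℕ → Blk p}
    (hH : ∀ k, k + 1 < 2 * m → (H k)ᴴ = H k) : (blockHankel m H).IsHermitian := by
  ext x y
  rw [Matrix.conjTranspose_apply, blockHankel, Matrix.of_apply, Matrix.of_apply,
    ← Matrix.conjTranspose_apply, hH _ (by omega), add_comm]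

theorem blockHankel_posDef_succ {r : ℕ} {H : ℕ → Blk p} (h : (blockHankel r H).PosDef)
    (hH : ∀ k, k + 1 < 2 * (r + 1) → (H k)ᴴ = H k)
    (hD : (H (2 * r) - (calH12 r H)ᴴ * matT r H * calH12 r H).PosDef) :
    (blockHankel (r + 1) H).PosDef := by
  have hS := blockHankel_isHermitian hH
  set S := blockHankel (r + 1) H with hSdef
  set D := H (2 * r) - (calH12 r H)ᴴ * matT r H * calH12 r H with hDdef
  set V := schurRow r H with hV
  have hDu := (Matrix.isUnit_iff_isUnit_det _).1 hD.isUnit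
  -- Block elimination: the row `V` annihilates the first `r` block columns of `S` and leaves the
  -- Schur complement in the last one.
  have hVS : V * S = D * matP2 (r + 1) p := by
    have h1 : V * S * emb r p = 0 := by
      rw [hV, schurRow, Matrix.sub_mul, Matrix.sub_mul, matP2_blockHankel_emb hS, Matrix.mul_assoc,
        Matrix.mul_assoc _ (emb r p)ᴴ, ← Matrix.mul_assoc, ← Matrix.mul_assoc,
          Matrix.mul_assoc _ _ (emb r p),
        ← Matrix.mul_assoc (_ * _)]
      rw [Matrix.mul_assoc (_ * _) (emb r p)ᴴ, Matrix.mul_assoc (_ * _), emb_blockHankel_emb,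
        Matrix.mul_assoc, matT_mul_blockHankel h, Matrix.mul_one, sub_self]
    have h2 : V * S * (matP2 (r + 1) p)ᴴ = D := by
      rw [Matrix.mul_assoc, hDdef, ← schurRow_mul]
    calc V * S = V * S * (emb r p * (emb r p)ᴴ + (matP2 (r + 1) p)ᴴ * matP2 (r + 1) p) := by
          rw [emb_mul_add, Matrix.mul_one]
      _ = _ := by
          rw [Matrix.mul_add, ← Matrix.mul_assoc, ← Matrix.mul_assoc, h1, h2, Matrix.zero_mul,
            zero_add]
  have hSV : S * Vᴴ = (matP2 (r + 1) p)ᴴ * D := by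
    have := congrArg Matrix.conjTranspose hVS
    rwa [Matrix.conjTranspose_mul, Matrix.conjTranspose_mul, hS.eq, hD.isHermitian.eq] at this
  set T' := emb r p * matT r H * (emb r p)ᴴ + Vᴴ * D⁻¹ * V with hT'
  have hT'pos : T'.PosSemidef := by
    refine Matrix.PosSemidef.add ?_ ?_
    · exact (matT_posDef h).posSemidef.mul_mul_conjTranspose_same _
    · exact hD.inv.posSemidef.conjTranspose_mul_mul_same _
  have hST : S * T' = 1 := by
    rw [eq_emb_add (S * T'), eq_emb_add (1 : BlockMat (r + 1) p)]
    have h0 : S * T' = S * (emb r p * matT r H * (emb r p)ᴴ) + (matP2 (r + 1) p)ᴴ * V := by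
      rw [hT', Matrix.mul_add, Matrix.mul_assoc Vᴴ, ← Matrix.mul_assoc S Vᴴ, hSV,
        Matrix.mul_assoc _ D,
        ← Matrix.mul_assoc D, Matrix.mul_nonsing_inv _ hDu, Matrix.one_mul]
    have h1 : (emb r p)ᴴ * (S * T') = (emb r p)ᴴ := by
      rw [h0, Matrix.mul_add, ← Matrix.mul_assoc _ _ V, conj_emb_mul_conj_matP2, Matrix.zero_mul,
        add_zero, ← Matrix.mul_assoc, ← Matrix.mul_assoc, ← Matrix.mul_assoc, emb_blockHankel_emb,
        blockHankel_mul_matT h, Matrix.one_mul]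
    have h2 : matP2 (r + 1) p * (S * T') = matP2 (r + 1) p := by
      rw [h0, Matrix.mul_add, ← Matrix.mul_assoc _ _ V, matP2_mul_conj, Matrix.one_mul,
        ← Matrix.mul_assoc, ← Matrix.mul_assoc, ← Matrix.mul_assoc, matP2_blockHankel_emb hS,
        hV, schurRow, add_sub_cancel]
    rw [h1, h2, Matrix.mul_one, Matrix.mul_one]
  -- `S = S T' S` is a congruence of the positive semidefinite right inverse; invertibility upgrades
  -- this to definiteness.
  have hSpos : S.PosSemidef := by
    have := hT'pos.conjTranspose_mul_mul_same S
    rwa [hS.eq, hST, Matrix.one_mul] at this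
  exact hSpos.posDef_iff_isUnit.2
    ((Matrix.isUnit_iff_isUnit_det _).2 (Matrix.isUnit_det_of_right_inverse hST))

section Congr

variable {H H' : ℕ → Blk p} {m r : ℕ}

theorem blockHankel_congr (h : ∀ k, k + 1 < 2 * m → H k = H' k) :
    blockHankel m H = blockHankel m H' := by
  ext x y
  simp only [blockHankel, Matrix.of_apply]
  rw [h _ (by omega)]

theorem matT_congr (h : ∀ k, k + 1 < 2 * m → H k = H' k) : matT m H = matT m H' := by
  rw [matT, matT, blockHankel_congr h]

theorem matPi_congr (h : ∀ k, k + 1 < m → H k = H' k) : matPi m H = matPi m H' := by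
  have : Phi1 m H = Phi1 m H' := by
    ext x b
    simp only [Phi1, Matrix.of_apply]
    split_ifs with hx
    · rfl
    · rw [h _ (by omega)]
  rw [matPi, matPi, this]

theorem verblunsky_congr (h : ∀ k ≤ 2 * r, H k = H' k) : verblunsky H r = verblunsky H' r := by
  rw [verblunsky, verblunsky, matT_congr fun k hk => h k (by omega),
    matPi_congr fun k hk => h k (by omega)]

theorem calH12_congr (h : ∀ k < 2 * r, H k = H' k) : calH12 r H = calH12 r H' := by
  ext x b
  simp only [calH12, Matrix.of_apply]
  rw [h _ (by omega)]

end Congr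

theorem calH12_eq_add {l : ℕ} {H H' : ℕ → Blk p} (h : ∀ k ≤ 2 * l, H k = H' k) :
    calH12 (l + 1) H = calH12 (l + 1) H' +
      (matP2 (l + 1) p)ᴴ * (H (2 * l + 1) - H' (2 * l + 1)) := by
  ext ⟨i, a⟩ b
  have e : ((matP2 (l + 1) p)ᴴ * (H (2 * l + 1) - H' (2 * l + 1))) (i, a) b =
      if (i : ℕ) = l then H (2 * l + 1) a b - H' (2 * l + 1) a b else 0 := by
    rw [Matrix.mul_apply, Finset.sum_eq_single a]
    · by_cases hi : (i : ℕ) = l <;> simp [matP2, hi]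
    · intro c _ hc
      simp [matP2, hc]
    · simp
  rw [Matrix.add_apply, e]
  simp only [calH12, Matrix.of_apply]
  split_ifs with hi
  · rw [hi, show l + 1 + l = 2 * l + 1 by ring]; ring
  · rw [h _ (by omega), add_zero]

/-- Two sequences which differ from the block `H_{2l+1}` on have coefficients `ω_{l+1}` whose
normalisations differ by a multiple of `ω_l`. -/
theorem inv_lastBlk_mul_verblunsky_sub {l : ℕ} {H H' : ℕ → Blk p}
    (hH : (blockHankel (l + 2) H).PosDef) (hH' : (blockHankel (l + 2) H').PosDef)
    (h : ∀ k ≤ 2 * l, H k = H' k) :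
    (lastBlk (l + 1) H')⁻¹ * verblunsky H' (l + 1) - (lastBlk (l + 1) H)⁻¹ * verblunsky H (l + 1) =
      (H (2 * l + 1) - H' (2 * l + 1)) * verblunsky H l := by
  have e1 : (H (2 * l + 1))ᴴ = H (2 * l + 1) := conjTranspose_of_posDef hH (by omega)
  have e2 : (H' (2 * l + 1))ᴴ = H' (2 * l + 1) := conjTranspose_of_posDef hH' (by omega)
  rw [inv_lastBlk_mul_verblunsky hH, inv_lastBlk_mul_verblunsky hH', matP2_matPi, matP2_matPi,
    h l (by omega), calH12_eq_add h, matT_congr (m := l + 1) (H' := H') fun k hk => h k (by omega),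
    matPi_congr (m := l + 1) (H' := H') fun k hk => h k (by omega), Matrix.conjTranspose_add,
    Matrix.conjTranspose_mul, Matrix.conjTranspose_conjTranspose, Matrix.conjTranspose_sub, e1, e2,
    Matrix.add_mul, Matrix.add_mul, verblunsky_congr h, verblunsky]
  simp only [Matrix.mul_assoc]
  abel

theorem lastBlk_eq_of_verblunsky_eq {n : ℕ} {H H' : ℕ → Blk p} (h : (blockHankel n H).PosDef)
    (h' : (blockHankel n H').PosDef) (hω : ∀ k < n, verblunsky H k = verblunsky H' k) {r : ℕ}
    (hr : r < n) : lastBlk r H = lastBlk r H' := by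
  cases r with
  | zero => rw [← verblunsky_zero_colBot, ← verblunsky_zero_colBot, hω 0 hr]
  | succ r =>
    rw [← verblunsky_mul_conj_pred (blockHankel_posDef_mono hr h),
      ← verblunsky_mul_conj_pred (blockHankel_posDef_mono hr h'), hω _ hr, hω r (by omega)]

theorem eq_schur {r : ℕ} {H : ℕ → Blk p} (h : (blockHankel (r + 1) H).PosDef) :
    H (2 * r) = (lastBlk r H)⁻¹ + (calH12 r H)ᴴ * matT r H * calH12 r H := by
  rw [inv_lastBlk h, sub_add_cancel]

theorem eq_of_verblunsky_eq {n : ℕ} {H H' : ℕ → Blk p} (h : (blockHankel n H).PosDef)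
    (h' : (blockHankel n H').PosDef) (hω : ∀ k < n, verblunsky H k = verblunsky H' k) :
    ∀ m ≤ n, ∀ k, k + 1 < 2 * m → H k = H' k := by
  intro m
  induction m with
  | zero => intro _ k hk; omega
  | succ r ih =>
    intro hr
    have ih := ih (by omega)
    have ht := lastBlk_eq_of_verblunsky_eq h h' hω (r := r) (by omega)
    have hS := blockHankel_posDef_mono hr h
    have hS' := blockHankel_posDef_mono hr h'
    have hodd : ∀ k < 2 * r, H k = H' k := by
      intro k hk
      rcases Nat.lt_or_ge (k + 1) (2 * r) with hk' | hk'
      · exact ih k hk'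
      · obtain ⟨l, rfl⟩ : ∃ l, r = l + 1 := ⟨r - 1, by omega⟩
        obtain rfl : k = 2 * l + 1 := by omega
        have key := inv_lastBlk_mul_verblunsky_sub hS hS' fun k hk => ih k (by omega)
        rw [ht, hω (l + 1) (by omega), sub_self] at key
        have hu := lastBlk_posDef hS
        rw [← verblunsky_mul_conj_pred hS] at hu
        -- The adjoint of `t_{l+1}` is `ω_l` times a column, so `ω_l` has a right inverse and can be
        -- cancelled from `key`.
        have hu' := hu.conjTranspose.isUnit
        have e : (Complex.I • (verblunsky H (l + 1) * matJ p * (verblunsky H l)ᴴ))ᴴ =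
            verblunsky H l * (star Complex.I • ((matJ p)ᴴ * (verblunsky H (l + 1))ᴴ)) := by
          rw [Matrix.conjTranspose_smul, Matrix.conjTranspose_mul, Matrix.conjTranspose_mul,
            Matrix.conjTranspose_conjTranspose, Matrix.mul_smul]
        rw [e] at hu'
        have := congrArg (· * (star Complex.I • ((matJ p)ᴴ * (verblunsky H (l + 1))ᴴ))) key
        simp only [Matrix.zero_mul, Matrix.mul_assoc] at this
        exact sub_eq_zero.1 (hu'.mul_left_eq_zero.1 this.symm)
    intro k hk
    rcases Nat.lt_or_ge k (2 * r) with hk' | hk'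
    · exact hodd k hk'
    · obtain rfl : k = 2 * r := by omega
      rw [eq_schur hS, eq_schur hS', ht, calH12_congr hodd, matT_congr fun k hk => ih k hk]

/-- A positive definite block Hankel matrix can be extended by one step, with prescribed Hermitian
odd block and prescribed Schur complement. -/
theorem exists_extension {l : ℕ} {H : ℕ → Blk p} (h : (blockHankel (l + 1) H).PosDef) {X D : Blk p}
    (hX : Xᴴ = X) (hD : D.PosDef) :
    ∃ H' : ℕ → Blk p, (∀ k ≤ 2 * l, H' k = H k) ∧ H' (2 * l + 1) = X ∧
      (blockHankel (l + 2) H').PosDef ∧ lastBlk (l + 1) H' = D := by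
  set H₁ := Function.update H (2 * l + 1) X with hH₁
  have hpos : (blockHankel (l + 1) H₁).PosDef := by
    rwa [blockHankel_congr (H' := H) fun k hk => Function.update_of_ne (by omega) _ _]
  -- This even block makes the new Schur complement equal to `D⁻¹`.
  set Y := D⁻¹ + (calH12 (l + 1) H₁)ᴴ * matT (l + 1) H₁ * calH12 (l + 1) H₁ with hY
  set H' := Function.update H₁ (2 * l + 2) Y with hH'
  have e0 : ∀ k ≤ 2 * l + 1, H' k = H₁ k := fun k hk => Function.update_of_ne (by omega) _ _
  have e1 : ∀ k ≤ 2 * l, H' k = H k := fun k hk => by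
    rw [e0 k (by omega)]; exact Function.update_of_ne (by omega) _ _
  have e2 : H' (2 * l + 1) = X := by rw [e0 _ le_rfl]; exact Function.update_self _ _ _
  have e3 : H' (2 * (l + 1)) = Y := Function.update_self _ _ _
  have hc : calH12 (l + 1) H' = calH12 (l + 1) H₁ := calH12_congr fun k hk => e0 k (by omega)
  have hT : matT (l + 1) H' = matT (l + 1) H₁ := matT_congr fun k hk => e0 k (by omega)
  have hs : H' (2 * (l + 1)) - (calH12 (l + 1) H')ᴴ * matT (l + 1) H' * calH12 (l + 1) H' = D⁻¹ := by
    rw [e3, hc, hT, hY, add_sub_cancel_right]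
  have hYh : Yᴴ = Y := by
    rw [hY, Matrix.conjTranspose_add, hD.inv.isHermitian.eq, Matrix.conjTranspose_mul,
      Matrix.conjTranspose_mul, Matrix.conjTranspose_conjTranspose,
      (matT_posDef hpos).isHermitian.eq, Matrix.mul_assoc]
  have hpos' : (blockHankel (l + 2) H').PosDef := by
    refine blockHankel_posDef_succ ?_ ?_ ?_
    · rwa [blockHankel_congr fun k hk => e0 k (by omega)]
    · intro k hk
      rcases Nat.lt_or_ge (2 * l) k with hk' | hk'
      · rcases Nat.lt_or_ge (2 * l + 1) k with hk'' | hk''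
        · obtain rfl : k = 2 * (l + 1) := by omega
          rw [e3, hYh]
        · obtain rfl : k = 2 * l + 1 := by omega
          rw [e2, hX]
      · rw [e1 k hk', conjTranspose_of_posDef h (by omega)]
    · rw [hs]; exact hD.inv
  refine ⟨H', e1, e2, hpos', ?_⟩
  have := inv_lastBlk hpos'
  rw [hs] at this
  exact Matrix.inv_inj this ((Matrix.isUnit_iff_isUnit_det _).1 (lastBlk_posDef hpos').isUnit)

theorem matJ_conjTranspose (p : ℕ) : (matJ p)ᴴ = matJ p := by
  rw [matJ, Matrix.fromBlocks_conjTranspose]; simp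

/-- The rows orthogonal to a maximal neutral family `ω` with respect to `J` are spanned by `ω`. -/
theorem eq_mul_of_neutral {ω L K : Row p} (hω : ω * matJ p * ωᴴ = 0)
    (hL : L * matJ p * Lᴴ = 0) (hLω : Complex.I • (L * matJ p * ωᴴ) = 1)
    (hK : K * matJ p * Kᴴ = 0) (hKω : Complex.I • (K * matJ p * ωᴴ) = 1) :
    ∃ X : Blk p, Xᴴ = X ∧ K - L = X * ω := by
  have hLω' : L * matJ p * ωᴴ = -Complex.I • 1 := by
    rw [← hLω, smul_smul]; simp
  have hKω' : K * matJ p * ωᴴ = -Complex.I • 1 := by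
    rw [← hKω, smul_smul]; simp
  have hωL : ω * matJ p * Lᴴ = Complex.I • 1 := by
    have := congrArg Matrix.conjTranspose hLω'
    simpa [Matrix.conjTranspose_mul, matJ_conjTranspose, Matrix.mul_assoc] using this
  -- The rows `ω`, `L` form a hyperbolic basis for `J`. The explicit inverse gives coordinates in
  -- it: the coefficient along `L` is the pairing with `ω`, which vanishes for `K - L`.
  have hMN : Matrix.fromRows ω L *
      (matJ p * Matrix.fromCols (Complex.I • Lᴴ) (-Complex.I • ωᴴ)) = -1 := by
    rw [← Matrix.mul_assoc, Matrix.fromRows_mul, Matrix.fromRows_mul_fromCols, Matrix.mul_smul,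
      Matrix.mul_smul, Matrix.mul_smul, Matrix.mul_smul, hω, hL, hLω', hωL, smul_smul, smul_smul]
    rw [← Matrix.fromBlocks_one, Matrix.fromBlocks_neg]
    simp
  have hNM : (matJ p * Matrix.fromCols (Complex.I • Lᴴ) (-Complex.I • ωᴴ)) *
      Matrix.fromRows ω L = -1 := by
    have := mul_eq_one_comm.1 (show (-Matrix.fromRows ω L) *
      (matJ p * Matrix.fromCols (Complex.I • Lᴴ) (-Complex.I • ωᴴ)) = 1 by
        rw [Matrix.neg_mul, hMN, neg_neg])
    rw [Matrix.mul_neg] at this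
    rw [← this, neg_neg]
  have hX : K - L = (-Complex.I • ((K - L) * matJ p * Lᴴ)) * ω := by
    have h1 : (K - L) * matJ p * ωᴴ = 0 := by
      rw [Matrix.sub_mul, Matrix.sub_mul, hKω', hLω', sub_self]
    calc K - L = -((K - L) * (matJ p * Matrix.fromCols (Complex.I • Lᴴ) (-Complex.I • ωᴴ) *
          Matrix.fromRows ω L)) := by rw [hNM]; simp
      _ = _ := by
        rw [← Matrix.mul_assoc, ← Matrix.mul_assoc, Matrix.mul_fromCols,
          Matrix.fromCols_mul_fromRows, Matrix.mul_smul, Matrix.mul_smul, h1]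
        simp
  refine ⟨_, ?_, hX⟩
  set X := -Complex.I • ((K - L) * matJ p * Lᴴ) with hXdef
  -- Inserted in `K J K* = 0`, this leaves only `i X - i X* = 0`.
  have hKe : K = L + X * ω := by rw [← hX]; abel
  rw [hKe, Matrix.conjTranspose_add, Matrix.conjTranspose_mul, Matrix.add_mul, Matrix.add_mul,
    Matrix.mul_add, Matrix.mul_add, hL, ← Matrix.mul_assoc, hLω', zero_add, Matrix.mul_assoc X,
    Matrix.mul_assoc X, hωL, Matrix.mul_assoc X (_ * _), ← Matrix.mul_assoc _ ωᴴ, hω] at hK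
  simp only [Matrix.neg_mul, Matrix.smul_mul, Matrix.mul_smul, Matrix.one_mul, Matrix.mul_one,
    Matrix.zero_mul,
    Matrix.mul_zero, add_zero, neg_smul] at hK
  rw [neg_add_eq_zero] at hK
  exact smul_right_injective _ Complex.I_ne_zero hK

theorem exists_hankel_of_verblunsky (ω : ℕ → Row p) (m : ℕ)
    (h0 : 0 < m → ω 0 * colTop p = 0 ∧ (ω 0 * colBot p).PosDef)
    (hs : ∀ k, k + 1 < m → ω (k + 1) * matJ p * (ω (k + 1))ᴴ = 0 ∧
      (Complex.I • (ω (k + 1) * matJ p * (ω k)ᴴ)).PosDef) :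
    ∃ H : ℕ → Blk p, (blockHankel m H).PosDef ∧ ∀ k < m, verblunsky H k = ω k := by
  induction m with
  | zero =>
    refine ⟨0, ?_, fun k hk => absurd hk (Nat.not_lt_zero k)⟩
    have : blockHankel 0 (0 : ℕ → Blk p) = 1 := by ext x; exact x.1.elim0
    rw [this]
    exact Matrix.PosDef.one
  | succ m ih =>
    obtain ⟨H, hH, hω⟩ := ih (fun h => h0 (by omega)) fun k hk => hs k (by omega)
    cases m with
    | zero =>
      obtain ⟨ht, hb⟩ := h0 one_pos
      have hbu := (Matrix.isUnit_iff_isUnit_det _).1 hb.isUnit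
      set H' : ℕ → Blk p := fun _ => (ω 0 * colBot p)⁻¹ with hH'
      have e : H' (2 * 0) - (calH12 0 H')ᴴ * matT 0 H' * calH12 0 H' = (ω 0 * colBot p)⁻¹ := by
        ext i j; simp [Matrix.mul_apply, hH']
      have hpos : (blockHankel 1 H').PosDef := by
        refine blockHankel_posDef_succ ?_ (fun k _ => hb.inv.isHermitian.eq) ?_
        · rwa [blockHankel_congr (H' := H) fun k hk => by omega]
        · rw [e]; exact hb.inv
      have hl : lastBlk 0 H' = ω 0 * colBot p := by
        have := inv_lastBlk hpos
        rw [e] at this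
        exact Matrix.inv_inj this ((Matrix.isUnit_iff_isUnit_det _).1 (lastBlk_posDef hpos).isUnit)
      have hcol : ∀ M : Row p, M = Matrix.fromCols (M * colTop p) (M * colBot p) := by
        intro M
        rw [← Matrix.mul_fromCols, colTop, colBot, Matrix.fromCols_fromRows_eq_fromBlocks,
          Matrix.fromBlocks_one, Matrix.mul_one]
      refine ⟨H', hpos, fun k hk => ?_⟩
      obtain rfl : k = 0 := by omega
      rw [hcol (verblunsky H' 0), hcol (ω 0), verblunsky_zero_colBot, verblunsky_zero_colTop, hl,
        ht]
    | succ l =>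
      obtain ⟨hn, ht⟩ := hs l (by omega)
      have hωl := hω l (by omega)
      -- A trial extension with last block `1`: its new coefficient `K` is neutral with `i K J ω_l*
      -- = 1`, the relations also satisfied by `t⁻¹ ω_{l+1}`.
      obtain ⟨H₀, hH₀, -, hpos₀, hl₀⟩ := exists_extension hH Matrix.conjTranspose_zero
        (Matrix.PosDef.one (n := Fin p) (R := ℂ))
      set t := Complex.I • (ω (l + 1) * matJ p * (ω l)ᴴ) with htdef
      have htu := (Matrix.isUnit_iff_isUnit_det _).1 ht.isUnit
      have hn₀ : verblunsky H₀ l = ω l := by rw [verblunsky_congr hH₀, hωl]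
      have hp₀ := verblunsky_mul_conj_pred hpos₀
      rw [hn₀, hl₀] at hp₀
      have hωneutral : ω l * matJ p * (ω l)ᴴ = 0 := by
        rw [← hωl]; exact verblunsky_neutral hH
      obtain ⟨X, hX, hXe⟩ := eq_mul_of_neutral (L := t⁻¹ * ω (l + 1)) hωneutral
        (by
          rw [Matrix.conjTranspose_mul, Matrix.mul_assoc, Matrix.mul_assoc,
            ← Matrix.mul_assoc _ _ (_)ᴴ,
            ← Matrix.mul_assoc (ω (l + 1)), ← Matrix.mul_assoc (ω (l + 1)), hn]
          simp)
        (by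
          rw [Matrix.mul_assoc, Matrix.mul_assoc, ← Matrix.mul_assoc (ω (l + 1)),
            ← Matrix.mul_smul, ← htdef, Matrix.nonsing_inv_mul _ htu])
        (verblunsky_neutral hpos₀) hp₀
      -- Raising the odd block by `X` subtracts `X ω_l` from the normalised coefficient, which
      -- carries `K` to `t⁻¹ ω_{l+1}`; the choice `D = t` restores the normalisation.
      obtain ⟨H', hH', hodd, hpos', hl'⟩ := exists_extension hH (X := (H₀ (2 * l + 1)) + X)
        (D := t) (by
          rw [Matrix.conjTranspose_add, hX, conjTranspose_of_posDef hpos₀ (by omega)]) ht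
      refine ⟨H', hpos', fun k hk => ?_⟩
      rcases Nat.lt_or_ge k (l + 1) with hk' | hk'
      · rw [verblunsky_congr fun j hj => hH' j (by omega), hω k hk']
      · obtain rfl : k = l + 1 := by omega
        have key := inv_lastBlk_mul_verblunsky_sub hpos' hpos₀ fun k hk => by
          rw [hH' k hk, hH₀ k hk]
        rw [hl₀, hl', hodd, add_sub_cancel_left, verblunsky_congr hH', hωl, ← hXe, inv_one,
          Matrix.one_mul, sub_right_inj] at key
        have := congrArg (t * ·) key
        simpa only [← Matrix.mul_assoc, Matrix.mul_nonsing_inv _ htu, Matrix.one_mul] using this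

theorem blockHankel_hankelBlock {n : ℕ} {M : BlockMat n p} (hM : IsBlockHankel M) :
    blockHankel n (hankelBlock M) = M := by
  ext ⟨i, a⟩ ⟨j, b⟩
  have h : (i : ℕ) + j < 2 * n - 1 := by omega
  simp only [blockHankel, hankelBlock, Matrix.of_apply, h, dif_pos]
  exact hM _ _ _ _ (by simp only; omega) a b

theorem isBlockHankel_blockHankel (n : ℕ) (H : ℕ → Blk p) : IsBlockHankel (blockHankel n H) := by
  intro i j i' j' h a b
  simp [blockHankel, h]

theorem hankelBlock_blockHankel {n k : ℕ} (H : ℕ → Blk p) (hk : k + 1 < 2 * n) :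
    hankelBlock (blockHankel n H) k = H k := by
  have h : k < 2 * n - 1 := by omega
  ext a b
  simp only [blockHankel, hankelBlock, Matrix.of_apply, h, dif_pos]
  rw [show k / 2 + (k - k / 2) = k by omega]

theorem bijOn_verblunsky (p n : ℕ) :
    Set.BijOn
      (fun (M : BlockMat n p) (k : Fin n) => verblunsky (hankelBlock M) (k : ℕ))
      (posDefHankel n p) {ω : Fin n → Row p | IsAdmissible ω} := by
  refine ⟨?_, ?_, ?_⟩
  · rintro M ⟨hM, hpos⟩
    rw [← blockHankel_hankelBlock hM] at hpos
    refine ⟨fun k hk => ?_, fun k l hkl => ?_⟩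
    · simp only [hk]
      have := blockHankel_posDef_mono (show 1 ≤ n by omega) hpos
      exact ⟨verblunsky_zero_colTop _, by
        rw [verblunsky_zero_colBot]; exact lastBlk_posDef this⟩
    · simp only [hkl]
      have := blockHankel_posDef_mono (show (l : ℕ) + 2 ≤ n by omega) hpos
      exact ⟨verblunsky_neutral this, by
        rw [verblunsky_mul_conj_pred this]; exact lastBlk_posDef this⟩
  · rintro M ⟨hM, hpos⟩ M' ⟨hM', hpos'⟩ h
    rw [← blockHankel_hankelBlock hM, ← blockHankel_hankelBlock hM']
    rw [← blockHankel_hankelBlock hM] at hpos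
    rw [← blockHankel_hankelBlock hM'] at hpos'
    exact blockHankel_congr (eq_of_verblunsky_eq hpos hpos'
      (fun k hk => congrFun h ⟨k, hk⟩) n le_rfl)
  · rintro ω ⟨h0, hs⟩
    obtain ⟨H, hH, hω⟩ := exists_hankel_of_verblunsky
      (fun k => if hk : k < n then ω ⟨k, hk⟩ else 0) n
      (fun hn => by simpa [hn] using h0 ⟨0, hn⟩ rfl)
      (fun k hk => by
        simpa [hk, show k < n by omega] using hs ⟨k + 1, hk⟩ ⟨k, by omega⟩ rfl)
    refine ⟨blockHankel n H, ⟨isBlockHankel_blockHankel n H, hH⟩, ?_⟩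
    ext1 k
    change verblunsky _ _ = _
    rw [verblunsky_congr fun j hj => hankelBlock_blockHankel H (by omega), hω k k.2]
    simp

/-! ### Nevanlinna functions in sectors; uniqueness of expansions -/

section Nevanlinna

open Complex Filter Topology

theorem eventually_sector (δ : ℝ) (R : ℝ) :
    ∀ᶠ z in sectorAtInfinity δ, R < ‖z‖ ∧ δ * ‖z‖ ≤ z.im := by
  refine (((tendsto_norm_cobounded_atTop (E := ℂ)).eventually_gt_atTop R).filter_mono
    inf_le_left).and ?_
  exact mem_inf_of_right (mem_principal_self _)

theorem normSq_sub_conj (z w : ℂ) :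
    ‖z - (starRingEnd ℂ) w‖ ^ 2 - ‖z - w‖ ^ 2 = 4 * (z.im * w.im) := by
  rw [← Complex.normSq_eq_norm_sq, ← Complex.normSq_eq_norm_sq, normSq_apply, normSq_apply]
  simp
  ring

theorem sub_conj_ne_zero {z w : ℂ} (hz : 0 < z.im) (hw : 0 < w.im) :
    z - (starRingEnd ℂ) w ≠ 0 := by
  intro h
  have := congrArg Complex.im h
  simp at this
  linarith

theorem norm_sub_lt {z w : ℂ} (hz : 0 < z.im) (hw : 0 < w.im) :
    ‖z - w‖ < ‖z - (starRingEnd ℂ) w‖ := by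
  have := normSq_sub_conj z w
  have h2 := mul_pos hz hw
  nlinarith [norm_nonneg (z - w), norm_nonneg (z - (starRingEnd ℂ) w)]

/-- The Schwarz--Pick lemma for the upper half-plane. -/
theorem schwarz_pick {M : ℂ → ℂ} (hM : DifferentiableOn ℂ M {z | 0 < z.im})
    (hpos : ∀ z : ℂ, 0 < z.im → 0 < (M z).im) {z w : ℂ} (hz : 0 < z.im) (hw : 0 < w.im) :
    ‖M z - M w‖ * ‖z - (starRingEnd ℂ) w‖ ≤ ‖M z - (starRingEnd ℂ) (M w)‖ * ‖z - w‖ := by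
  -- `κ` maps the disc to the half-plane with `κ 0 = w`. Together with the Cayley transform centred
  -- at `M w` it reduces the claim to Schwarz's lemma.
  set κ : ℂ → ℂ := fun ζ => (w - (starRingEnd ℂ) w * ζ) / (1 - ζ) with hκ
  have hne : ∀ ζ ∈ Metric.ball (0 : ℂ) 1, 1 - ζ ≠ 0 := by
    intro ζ hζ h
    rw [mem_ball_zero_iff, ← sub_eq_zero.1 h] at hζ
    simp at hζ
  have hκim : ∀ ζ ∈ Metric.ball (0 : ℂ) 1, 0 < (κ ζ).im := by
    intro ζ hζ
    have h1 : 0 < normSq (1 - ζ) := normSq_pos.2 (hne ζ hζ)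
    have h2 : normSq ζ < 1 := by
      rw [mem_ball_zero_iff] at hζ
      rw [normSq_eq_norm_sq]
      nlinarith [norm_nonneg ζ]
    have : (κ ζ).im = w.im * (1 - normSq ζ) / normSq (1 - ζ) := by
      rw [hκ]
      simp only [div_im, sub_re, sub_im, mul_re, mul_im, conj_re, conj_im, one_re, one_im]
      rw [normSq_apply ζ]
      ring
    rw [this]
    exact div_pos (mul_pos hw (by linarith)) h1
  have hκd : DifferentiableOn ℂ κ (Metric.ball 0 1) := by
    refine DifferentiableOn.div (by fun_prop) (by fun_prop) hne
  set f : ℂ → ℂ := fun ζ => (M (κ ζ) - M w) / (M (κ ζ) - (starRingEnd ℂ) (M w)) with hf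
  have hMκ : DifferentiableOn ℂ (fun ζ => M (κ ζ)) (Metric.ball 0 1) :=
    hM.comp hκd fun ζ hζ => hκim ζ hζ
  have hfd : DifferentiableOn ℂ f (Metric.ball 0 1) :=
    (hMκ.sub_const _).div (hMκ.sub_const _) fun ζ hζ =>
      sub_conj_ne_zero (hpos _ (hκim ζ hζ)) (hpos w hw)
  have hmaps : Set.MapsTo f (Metric.ball 0 1) (Metric.ball 0 1) := by
    intro ζ hζ
    rw [mem_ball_zero_iff, hf, norm_div, div_lt_one (norm_pos_iff.2
      (sub_conj_ne_zero (hpos _ (hκim ζ hζ)) (hpos w hw)))]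
    exact norm_sub_lt (hpos _ (hκim ζ hζ)) (hpos w hw)
  have hf0 : f 0 = 0 := by simp [hf, hκ]
  have hzw := sub_conj_ne_zero hz hw
  set ζ := (z - w) / (z - (starRingEnd ℂ) w) with hζdef
  have hζ : ‖ζ‖ < 1 := by
    rw [hζdef, norm_div, div_lt_one (norm_pos_iff.2 hzw)]
    exact norm_sub_lt hz hw
  have hκζ : κ ζ = z := by
    have h1 := hne ζ (mem_ball_zero_iff.2 hζ)
    rw [hκ]
    simp only
    rw [div_eq_iff h1, hζdef]
    field_simp
    ring
  have key := norm_le_norm_of_mapsTo_ball hfd (hmaps.mono_right Metric.ball_subset_closedBall) hf0 hζ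
  rw [hf] at key
  simp only [hκζ] at key
  rw [hζdef, norm_div, norm_div, div_le_div_iff₀ (norm_pos_iff.2
    (sub_conj_ne_zero (hpos z hz) (hpos w hw))) (norm_pos_iff.2 hzw)] at key
  rw [mul_comm ‖M z - (starRingEnd ℂ) (M w)‖]
  exact key

/-- Schwarz–Pick and the triangle inequality bound `a (P - q)`; multiplying by `P + q` brings in `P²
- q² = 4 Im z Im w`. The bound is linear in `Im M(w)`, so a point `w` where this is small controls
`M` in whole sectors. -/
theorem schwarz_pick_growth {M : ℂ → ℂ} (hM : DifferentiableOn ℂ M {z | 0 < z.im})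
    (hpos : ∀ z : ℂ, 0 < z.im → 0 < (M z).im) {z w : ℂ} (hz : 0 < z.im) (hw : 0 < w.im) :
    ‖M z - (starRingEnd ℂ) (M w)‖ * (z.im * w.im) ≤
      (M w).im * ‖z - (starRingEnd ℂ) w‖ ^ 2 := by
  have h1 := schwarz_pick hM hpos hz hw
  have h2 := normSq_sub_conj z w
  have h3 := norm_sub_lt hz hw
  have h4 : ‖M z - (starRingEnd ℂ) (M w)‖ ≤ ‖M z - M w‖ + 2 * (M w).im := by
    have : M z - (starRingEnd ℂ) (M w) = (M z - M w) + ((2 * (M w).im : ℝ) : ℂ) * I := by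
      rw [← Complex.sub_conj]; ring
    rw [this]
    refine (norm_add_le _ _).trans ?_
    rw [norm_mul, norm_I, mul_one, norm_real, Real.norm_of_nonneg (by linarith [hpos w hw])]
  set a := ‖M z - (starRingEnd ℂ) (M w)‖
  set b := ‖M z - M w‖
  set P := ‖z - (starRingEnd ℂ) w‖
  set q := ‖z - w‖
  have hq : 0 ≤ q := norm_nonneg _
  have ha : 0 ≤ a := norm_nonneg _
  have hP : 0 < P := hq.trans_lt h3
  have h5 : a * (P - q) ≤ 2 * (M w).im * P := by nlinarith
  have h6 : a * (P - q) * (P + q) ≤ 2 * (M w).im * P * (P + q) :=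
    mul_le_mul_of_nonneg_right h5 (by linarith)
  have h7 : 2 * (M w).im * P * (P + q) ≤ 2 * (M w).im * P * (P + P) := by
    have := hpos w hw
    gcongr
  nlinarith

/-- A holomorphic function on the upper half-plane with nonnegative imaginary part is
asymptotically linear in sectors. -/
theorem exists_tendsto_div {N : ℂ → ℂ} (hN : DifferentiableOn ℂ N {z | 0 < z.im})
    (hpos : ∀ z : ℂ, 0 < z.im → 0 ≤ (N z).im) :
    ∃ β : ℝ, (∀ c : ℝ, (∀ z : ℂ, 0 < z.im → c * z.im ≤ (N z).im) → c ≤ β) ∧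
      ∀ δ : ℝ, 0 < δ → Tendsto (fun z => N z / z) (sectorAtInfinity δ) (𝓝 β) := by
  set A : Set ℝ := (fun z : ℂ => (N z).im / z.im) '' {z | 0 < z.im} with hA
  have hAne : A.Nonempty := ⟨_, I, by simp, rfl⟩
  have hAbdd : BddBelow A := ⟨0, by
    rintro _ ⟨z, hz, rfl⟩
    exact div_nonneg (hpos z hz) (le_of_lt hz)⟩
  set β := sInf A with hβ
  have hβle : ∀ z : ℂ, 0 < z.im → β * z.im ≤ (N z).im := fun z hz =>
    (le_div_iff₀ hz).1 (csInf_le hAbdd ⟨z, hz, rfl⟩)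
  refine ⟨β, fun c hc => le_csInf hAne ?_, fun δ hδ => ?_⟩
  · rintro _ ⟨z, hz, rfl⟩
    exact (le_div_iff₀ hz).2 (hc z hz)
  rw [Metric.tendsto_nhds]
  intro ε hε
  -- The error will be at most `8/δ` units of `η‖z‖` from the growth bound, plus one each for `M w`
  -- and the added constant; `3` leaves slack.
  set η := ε / (3 + 8 / δ) with hη
  have hden : 0 < 3 + 8 / δ := by positivity
  have hηpos : 0 < η := by positivity
  obtain ⟨_, ⟨w, hw, rfl⟩, hwlt⟩ := exists_lt_of_csInf_lt hAne (show β < β + η by linarith)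
  have hw : 0 < w.im := hw
  rw [div_lt_iff₀ hw] at hwlt
  -- Subtracting `β z` keeps the imaginary part nonnegative, since `β` is the infimum of `Im N / Im
  -- z`. The constant makes it strictly positive, while at the near-minimiser `w` it stays below `2
  -- η Im w`.
  set M : ℂ → ℂ := fun z => N z - β * z + (η * w.im : ℝ) * I with hMdef
  have hMim : ∀ z, (M z).im = (N z).im - β * z.im + η * w.im := fun z => by
    simp [hMdef]
  have hMd : DifferentiableOn ℂ M {z | 0 < z.im} := by
    refine (hN.sub ?_).add_const _
    fun_prop
  have hMpos : ∀ z : ℂ, 0 < z.im → 0 < (M z).im := fun z hz => by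
    rw [hMim]; nlinarith [hβle z hz, mul_pos hηpos hw]
  filter_upwards [eventually_sector δ (max ‖w‖ (‖M w‖ / η))] with z hz
  obtain ⟨hzn, hzs⟩ := hz
  obtain ⟨hz1, hz2⟩ := max_lt_iff.1 hzn
  have hz0 : 0 < ‖z‖ := (norm_nonneg w).trans_lt hz1
  have hzim : 0 < z.im := (mul_pos hδ hz0).trans_le hzs
  have hg := schwarz_pick_growth hMd hMpos hzim hw
  have hMw : (M w).im ≤ 2 * η * w.im := by rw [hMim]; nlinarith
  have hP : ‖z - (starRingEnd ℂ) w‖ ^ 2 ≤ 4 * ‖z‖ ^ 2 := by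
    have : ‖z - (starRingEnd ℂ) w‖ ≤ 2 * ‖z‖ := by
      refine (norm_sub_le _ _).trans ?_
      rw [RCLike.norm_conj]; linarith
    nlinarith [norm_nonneg (z - (starRingEnd ℂ) w)]
  set a := ‖M z - (starRingEnd ℂ) (M w)‖ with ha
  have ha0 : 0 ≤ a := norm_nonneg _
  have h1 : a * (δ * ‖z‖) ≤ 8 * η * ‖z‖ ^ 2 := by
    have h2 : a * (z.im * w.im) ≤ (2 * η * w.im) * (4 * ‖z‖ ^ 2) :=
      hg.trans (mul_le_mul hMw hP (by positivity) (by positivity))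
    have h3 : a * z.im ≤ 8 * η * ‖z‖ ^ 2 := by
      refine le_of_mul_le_mul_right ?_ hw
      linarith
    exact (mul_le_mul_of_nonneg_left hzs ha0).trans h3
  have h4 : a ≤ 8 / δ * η * ‖z‖ := by
    refine le_of_mul_le_mul_right ?_ (mul_pos hδ hz0)
    calc a * (δ * ‖z‖) ≤ 8 * η * ‖z‖ ^ 2 := h1
      _ = _ := by field_simp
  have h5 : ‖M w‖ < η * ‖z‖ := by
    rw [div_lt_iff₀ hηpos] at hz2; linarith
  have h6 : ‖N z - β * z‖ < ε * ‖z‖ := by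
    have e : N z - β * z = (M z - (starRingEnd ℂ) (M w)) + (starRingEnd ℂ) (M w) -
        (η * w.im : ℝ) * I := by simp only [hMdef]; ring
    have h7 : ‖((η * w.im : ℝ) : ℂ) * I‖ ≤ η * ‖z‖ := by
      rw [norm_mul, norm_I, mul_one, norm_real, Real.norm_of_nonneg (by positivity)]
      have := (le_abs_self _).trans (abs_im_le_norm w)
      gcongr
      linarith
    rw [e]
    refine (norm_sub_le _ _).trans_lt ?_
    have h8 := norm_add_le (M z - (starRingEnd ℂ) (M w)) ((starRingEnd ℂ) (M w))
    rw [RCLike.norm_conj] at h8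
    have h9 : ε * ‖z‖ = 8 / δ * η * ‖z‖ + 3 * (η * ‖z‖) := by
      rw [hη]; field_simp; ring
    rw [h9]
    have := mul_pos hηpos hz0
    linarith
  have hzne : z ≠ 0 := norm_pos_iff.1 hz0
  rw [dist_eq_norm, show N z / z - β = (N z - β * z) / z by field_simp, norm_div,
    div_lt_iff₀ hz0]
  exact h6

/-- A Nevanlinna function `h` with `Im z |h|² ≤ s Im h` has a nontangential expansion `c / z` at
infinity. -/
theorem exists_tendsto_mul {h : ℂ → ℂ} (hd : DifferentiableOn ℂ h {z | 0 < z.im}) {s : ℝ}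
    (hs : 0 ≤ s) (hpos : ∀ z : ℂ, 0 < z.im → 0 ≤ (h z).im)
    (hb : ∀ z : ℂ, 0 < z.im → z.im * ‖h z‖ ^ 2 ≤ s * (h z).im) :
    ∃ c : ℂ, ∀ δ : ℝ, 0 < δ → Tendsto (fun z => z * h z) (sectorAtInfinity δ) (𝓝 c) := by
  have hne : ∀ z : ℂ, 0 < z.im → z ≠ 0 := by rintro z hz rfl; simp at hz
  -- Subtracting `1/z` makes the imaginary part strictly positive, so `g` has no zeros even when `h`
  -- does.
  set g : ℂ → ℂ := fun z => h z - z⁻¹ with hg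
  have hgim : ∀ z : ℂ, (g z).im = (h z).im + z.im / ‖z‖ ^ 2 := fun z => by
    simp [hg, inv_im, normSq_eq_norm_sq, neg_div]
  have hgpos : ∀ z : ℂ, 0 < z.im → 0 < (g z).im := fun z hz => by
    have := norm_pos_iff.2 (hne z hz)
    rw [hgim]
    have := hpos z hz
    positivity
  have hgne : ∀ z : ℂ, 0 < z.im → g z ≠ 0 := fun z hz h0 => by
    have := hgpos z hz
    simp [h0] at this
  have hgd : DifferentiableOn ℂ g {z | 0 < z.im} :=
    hd.sub (differentiableOn_inv.mono fun z hz => hne z hz)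
  have hgb : ∀ z : ℂ, 0 < z.im → z.im * ‖g z‖ ^ 2 ≤ (2 * s + 2) * (g z).im := fun z hz => by
    have h1 : ‖g z‖ ≤ ‖h z‖ + ‖z‖⁻¹ := by
      rw [← norm_inv]; exact norm_sub_le _ _
    have h2 : ‖g z‖ ^ 2 ≤ 2 * ‖h z‖ ^ 2 + 2 * (‖z‖⁻¹) ^ 2 := by
      nlinarith [norm_nonneg (g z), sq_nonneg (‖h z‖ - ‖z‖⁻¹)]
    have h3 := hb z hz
    have h4 := hpos z hz
    have h5 : 0 ≤ z.im * (‖z‖⁻¹) ^ 2 := by positivity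
    have h6 : (g z).im = (h z).im + z.im * (‖z‖⁻¹) ^ 2 := by
      rw [hgim, inv_pow, div_eq_mul_inv]
    rw [h6]
    calc z.im * ‖g z‖ ^ 2 ≤ z.im * (2 * ‖h z‖ ^ 2 + 2 * (‖z‖⁻¹) ^ 2) := by gcongr
      _ ≤ _ := by nlinarith [mul_nonneg hs h5]
  -- The bound on `g` says `Im N ≥ Im z / (2s + 2)`, so the slope `β` of `N` is positive and can be
  -- inverted: `z g → -1/β`.
  set N : ℂ → ℂ := fun z => -(g z)⁻¹ with hN
  have hNim : ∀ z : ℂ, 0 < z.im → 1 / (2 * s + 2) * z.im ≤ (N z).im := fun z hz => by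
    have h1 : (N z).im = (g z).im / ‖g z‖ ^ 2 := by
      simp [hN, inv_im, normSq_eq_norm_sq, neg_div]
    have := norm_pos_iff.2 (hgne z hz)
    rw [h1, le_div_iff₀ (by positivity), one_div, mul_assoc, inv_mul_le_iff₀ (by positivity)]
    exact hgb z hz
  obtain ⟨β, hβ, hlim⟩ := exists_tendsto_div (N := N)
    ((hgd.inv fun z hz => hgne z hz).neg) fun z hz => by
      refine le_trans ?_ (hNim z hz)
      positivity
  have hβpos : 0 < β := lt_of_lt_of_le (by positivity) (hβ _ hNim)
  refine ⟨-(β : ℂ)⁻¹ + 1, fun δ hδ => ?_⟩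
  have h1 := (((hlim δ hδ).inv₀ (ofReal_ne_zero.2 hβpos.ne')).neg).add_const (1 : ℂ)
  refine h1.congr' ?_
  filter_upwards [eventually_sector δ 0] with z hz
  have hz0 : z ≠ 0 := norm_pos_iff.1 hz.1
  have : 0 < z.im := (mul_pos hδ hz.1).trans_le hz.2
  have := hgne z this
  simp only [hN]
  rw [show h z = g z + z⁻¹ by simp [hg]]
  field_simp

theorem sectorAtInfinity_half_neBot : (sectorAtInfinity (1 / 2)).NeBot := by
  have h : Tendsto (fun t : ℝ => (t : ℂ) * I) atTop (sectorAtInfinity (1 / 2)) := by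
    refine tendsto_inf.2 ⟨?_, tendsto_principal.2 ?_⟩
    · rw [← tendsto_norm_atTop_iff_cobounded]
      simpa using tendsto_abs_atTop_atTop
    · filter_upwards [eventually_ge_atTop 0] with t ht
      simp only [norm_mul, norm_real, norm_I, Real.norm_of_nonneg ht]
      simp
      linarith
  exact h.neBot

theorem eq_zero_of_isLittleO {N : ℕ} {d : ℕ → ℂ} {l : Filter ℂ} [l.NeBot]
    (hl : l ≤ Bornology.cobounded ℂ)
    (h : (fun z : ℂ => ∑ k ∈ Finset.range N, (z ^ (k + 1))⁻¹ * d k) =o[l] fun z => (z ^ N)⁻¹) :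
    ∀ k < N, d k = 0 := by
  intro k
  induction k using Nat.strong_induction_on with
  | _ k ih =>
    intro hk
    have hz : ∀ᶠ z : ℂ in l, z ≠ 0 := hl (Bornology.eventually_ne_cobounded 0)
    have hinv : Tendsto (fun z : ℂ => z⁻¹) l (𝓝 0) := tendsto_inv₀_cobounded.mono_left hl
    -- This is the sum multiplied by `z^(k+1)`. Terms with `j < k` vanish by induction and are set
    -- to `0`, because `j - k` would truncate.
    have h1 : Tendsto (fun z : ℂ => ∑ j ∈ Finset.range N,
        (if j < k then 0 else z⁻¹ ^ (j - k) * d j)) l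
        (𝓝 (∑ j ∈ Finset.range N, if j = k then d k else 0)) := by
      refine tendsto_finsetSum _ fun j _ => ?_
      rcases lt_trichotomy j k with hj | hj | hj
      · simp [hj, hj.ne]
      · simp [hj]
      · simp only [hj.not_gt, hj.ne', if_false]
        have := (hinv.pow (j - k)).mul_const (d j)
        rwa [zero_pow (by omega), zero_mul] at this
    have h2 : Tendsto (fun z : ℂ => ∑ j ∈ Finset.range N,
        (if j < k then 0 else z⁻¹ ^ (j - k) * d j)) l (𝓝 0) := by
      have h3 : (fun z : ℂ => z ^ (k + 1) * ∑ j ∈ Finset.range N, (z ^ (j + 1))⁻¹ * d j) =o[l]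
          fun _ => (1 : ℂ) := by
        refine ((Asymptotics.isBigO_refl (fun z : ℂ => z ^ (k + 1)) l).mul_isLittleO h).trans_isBigO
          ?_
        have h4 := (hinv.pow (N - (k + 1))).isBigO_one ℂ
        refine h4.congr' ?_ EventuallyEq.rfl
        filter_upwards [hz] with z hz
        rw [inv_pow, ← div_eq_mul_inv, inv_eq_one_div,
          div_eq_div_iff (by positivity) (by positivity), ← pow_add,
          one_mul]
        congr 1
        omega
      refine ((Asymptotics.isLittleO_one_iff ℂ).1 h3).congr' ?_
      filter_upwards [hz] with z hz
      rw [Finset.mul_sum]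
      refine Finset.sum_congr rfl fun j hj => ?_
      split_ifs with hjk
      · rw [ih j hjk (hjk.trans hk)]; simp
      · rw [inv_pow, ← mul_assoc, show j + 1 = (j - k) + (k + 1) by omega,
        pow_add z (j - k) (k + 1)]
        field_simp
    have h5 := tendsto_nhds_unique h1 h2
    rwa [Finset.sum_ite_eq' , if_pos (Finset.mem_range.2 hk)] at h5

theorem HasNontangentialExpansion.unique {p N : ℕ} {φ : ℂ → Blk p} {c c' : ℕ → Blk p}
    (h : HasNontangentialExpansion φ N c) (h' : HasNontangentialExpansion φ N c') :
    ∀ k < N, c k = c' k := by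
  intro k hk
  ext a b
  have := sectorAtInfinity_half_neBot
  have h1 := (h' (1 / 2) (by norm_num) a b).sub (h (1 / 2) (by norm_num) a b)
  refine sub_eq_zero.1 (eq_zero_of_isLittleO (N := N) (d := fun k => c k a b - c' k a b)
    (l := sectorAtInfinity (1 / 2)) inf_le_left (h1.congr_left fun z => ?_) k hk)
  simp only [mul_sub, Finset.sum_sub_distrib]
  ring

end Nevanlinna

/-! ### The `J`-form of `𝔄` and invertibility of `𝔄₂ Q` -/

theorem matJ_eq (p : ℕ) : matJ p = colTop p * (colBot p)ᴴ + colBot p * (colTop p)ᴴ := by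
  simp only [matJ, colTop, colBot, Matrix.conjTranspose_fromRows_eq_fromCols_conjTranspose,
    Matrix.fromRows_mul_fromCols]
  simp [Matrix.fromBlocks_add]

theorem colTop_mul_add (p : ℕ) : colTop p * (colTop p)ᴴ + colBot p * (colBot p)ᴴ = 1 := by
  simp only [colTop, colBot, Matrix.conjTranspose_fromRows_eq_fromCols_conjTranspose,
    Matrix.fromRows_mul_fromCols]
  simp [Matrix.fromBlocks_add]

theorem matPi_mul_matJ (m : ℕ) (H : ℕ → Blk p) :
    matPi m H * matJ p = Phi1 m H * (colBot p)ᴴ + Phi2 m p * (colTop p)ᴴ := by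
  simp only [matPi, matJ, colTop, colBot, Matrix.conjTranspose_fromRows_eq_fromCols_conjTranspose,
    Matrix.fromCols_mul_fromBlocks, Matrix.mul_fromCols]
  ext i j
  cases j <;> simp

theorem Phi2_conj_mul (r p : ℕ) : (Phi2 (r + 1) p)ᴴ * Phi2 (r + 1) p = 1 := by
  ext a b
  rw [Matrix.mul_apply, Fintype.sum_prod_type, Fin.sum_univ_succ]
  simp [Phi2, Matrix.one_apply, eq_comm]

/-- The factor `(A* - 1 / z)⁻¹ T Π J` of the function `𝔄(z)`. -/
def resolventCol (m : ℕ) (H : ℕ → Blk p) (z : ℂ) : Matrix (Fin m × Fin p) (Fin p ⊕ Fin p) ℂ :=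
  ((shiftA m p - (1 / (starRingEnd ℂ) z) • (1 : BlockMat m p))⁻¹)ᴴ * matT m H * matPi m H * matJ p

section Transfer

variable {m : ℕ} {H : ℕ → Blk p} {z : ℂ}

theorem frakA_eq (h : (blockHankel m H).PosDef) :
    frakA m H z = 1 + Complex.I • ((matPi m H)ᴴ * resolventCol m H z) := by
  have hT := (matT_posDef h).isHermitian.eq
  rw [matT] at hT
  rw [frakA, transfer, resolventCol, Matrix.conjTranspose_sub, Matrix.conjTranspose_one,
    Matrix.conjTranspose_smul]
  simp only [Matrix.conjTranspose_mul, Matrix.conjTranspose_conjTranspose, hT, matJ_conjTranspose,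
    Matrix.mul_assoc, matT]
  simp [sub_eq_add_neg]

theorem mul_resolventCol (h : (blockHankel m H).PosDef) (hz : z ≠ 0) :
    blockHankel m H * (((shiftA m p)ᴴ - z⁻¹ • (1 : BlockMat m p)) * resolventCol m H z) =
      matPi m H * matJ p := by
  have hu : 1 / (starRingEnd ℂ) z ≠ 0 := by simpa using hz
  have h1 := congrArg Matrix.conjTranspose
    (Matrix.nonsing_inv_mul _ (isUnit_det_shiftA_sub m (p := p) hu))
  rw [Matrix.conjTranspose_mul, Matrix.conjTranspose_one, Matrix.conjTranspose_sub,
    Matrix.conjTranspose_smul, Matrix.conjTranspose_one,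
    show star (1 / (starRingEnd ℂ) z) = z⁻¹ by simp] at h1
  simp only [resolventCol, Matrix.mul_assoc]
  rw [← Matrix.mul_assoc _ _ (matT m H * _), h1, Matrix.one_mul, ← Matrix.mul_assoc,
    blockHankel_mul_matT h, Matrix.one_mul]

theorem I_smul_matPi_matJ_conj_matPi (h : (blockHankel m H).PosDef) :
    Complex.I • (matPi m H * matJ p * (matPi m H)ᴴ) =
      shiftA m p * blockHankel m H - blockHankel m H * (shiftA m p)ᴴ :=
  (displacement m H fun _ hk => conjTranspose_of_posDef h (by omega)).symm

/-- The displacement identity trades the factor `A* - 1/z` on the right of `H` for `A - 1/z` on its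
left. -/
theorem matPi_mul_frakA (h : (blockHankel m H).PosDef) (hz : z ≠ 0) :
    matPi m H * matJ p * frakA m H z =
      (shiftA m p - z⁻¹ • (1 : BlockMat m p)) * (blockHankel m H * resolventCol m H z) := by
  rw [frakA_eq h, Matrix.mul_add, Matrix.mul_one, Matrix.mul_smul, ← Matrix.mul_assoc,
    ← Matrix.smul_mul, I_smul_matPi_matJ_conj_matPi h, ← mul_resolventCol h hz]
  simp only [Matrix.sub_mul, Matrix.mul_sub, Matrix.mul_assoc, Matrix.smul_mul, Matrix.mul_smul,
    Matrix.one_mul]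
  abel

theorem conj_frakA_mul (h : (blockHankel m H).PosDef) (hz : z ≠ 0) :
    (frakA m H z)ᴴ * matJ p * frakA m H z = matJ p +
      ((2 * z.im / ‖z‖ ^ 2 : ℝ) : ℂ) •
        ((resolventCol m H z)ᴴ * blockHankel m H * resolventCol m H z) := by
  set G := resolventCol m H z with hG
  set S := blockHankel m H with hS
  set A := shiftA m p with hA
  have h1 := mul_resolventCol h hz
  have h2 := congrArg Matrix.conjTranspose h1
  rw [← hG, ← hS, ← hA] at h1 h2
  simp only [Matrix.conjTranspose_mul, h.isHermitian.eq, matJ_conjTranspose,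
    Matrix.conjTranspose_sub, Matrix.conjTranspose_conjTranspose, Matrix.conjTranspose_smul,
    Matrix.conjTranspose_one] at h2
  have h3 := I_smul_matPi_matJ_conj_matPi h
  have hc : ((2 * z.im / ‖z‖ ^ 2 : ℝ) : ℂ) = Complex.I * (z⁻¹ - star z⁻¹) := by
    rw [Complex.star_def, Complex.sub_conj, Complex.inv_im, Complex.normSq_eq_norm_sq]
    push_cast
    linear_combination (2 * (z.im : ℂ) / ‖z‖ ^ 2) * Complex.I_sq
  have e : (frakA m H z)ᴴ * matJ p * frakA m H z = matJ p +
      Complex.I • (matJ p * (matPi m H)ᴴ * G) - Complex.I • (Gᴴ * (matPi m H * matJ p)) +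
        -Complex.I • (Gᴴ * (Complex.I • (matPi m H * matJ p * (matPi m H)ᴴ)) * G) := by
    rw [frakA_eq h, Matrix.conjTranspose_add, Matrix.conjTranspose_smul, Matrix.conjTranspose_mul,
      Matrix.conjTranspose_conjTranspose, Matrix.conjTranspose_one, ← hG]
    simp only [Matrix.add_mul, Matrix.mul_add, Matrix.one_mul, Matrix.mul_one, Matrix.smul_mul,
      Matrix.mul_smul, smul_smul, Matrix.mul_assoc, Complex.star_def, Complex.conj_I, smul_add,
      neg_smul, neg_mul]
    match_scalars <;> simp
  rw [e, h3, ← h2, ← h1, hc]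
  simp only [Matrix.sub_mul, Matrix.mul_sub, Matrix.mul_assoc, Matrix.smul_mul, Matrix.mul_smul,
    Matrix.one_mul, Matrix.mul_one, smul_sub, smul_smul, mul_sub, sub_smul, neg_smul]
  abel

theorem conj_mul_matJ_mul {k : Type*} [Fintype k] (X : Matrix (Fin p ⊕ Fin p) k ℂ) :
    Xᴴ * matJ p * X = ((colTop p)ᴴ * X)ᴴ * ((colBot p)ᴴ * X) +
      ((colBot p)ᴴ * X)ᴴ * ((colTop p)ᴴ * X) := by
  rw [matJ_eq]
  simp only [Matrix.conjTranspose_mul, Matrix.conjTranspose_conjTranspose, Matrix.mul_add,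
    Matrix.add_mul, Matrix.mul_assoc]

theorem frakA_mul_form (h : (blockHankel m H).PosDef) (hz : z ≠ 0) (ζ : Col p) :
    (frakA1 m H z * ζ)ᴴ * (frakA2 m H z * ζ) + (frakA2 m H z * ζ)ᴴ * (frakA1 m H z * ζ) =
      ζᴴ * matJ p * ζ + ((2 * z.im / ‖z‖ ^ 2 : ℝ) : ℂ) •
        ((resolventCol m H z * ζ)ᴴ * blockHankel m H * (resolventCol m H z * ζ)) := by
  have := conj_mul_matJ_mul (frakA m H z * ζ)
  rw [frakA1, frakA2, Matrix.mul_assoc, Matrix.mul_assoc, ← this]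
  have e : (frakA m H z * ζ)ᴴ * matJ p * (frakA m H z * ζ) =
      ζᴴ * ((frakA m H z)ᴴ * matJ p * frakA m H z) * ζ := by
    simp only [Matrix.conjTranspose_mul, Matrix.mul_assoc]
  rw [e, conj_frakA_mul h hz]
  simp only [Matrix.conjTranspose_mul, Matrix.mul_assoc, Matrix.mul_add, Matrix.add_mul,
    Matrix.mul_smul, Matrix.smul_mul]

end Transfer

theorem star_dotProduct_conj_mul_mulVec {k l : Type*} [Fintype k] [Fintype l]
    (M N : Matrix l k ℂ) (x : k → ℂ) :
    star x ⬝ᵥ (Mᴴ * N) *ᵥ x = star (M *ᵥ x) ⬝ᵥ (N *ᵥ x) := by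
  rw [← Matrix.mulVec_mulVec, Matrix.dotProduct_mulVec, Matrix.star_mulVec]

/-- If `𝔄₂ Q x = 0`, the `J`-form at `𝔄 Q x` is zero, so both nonnegative summands vanish and `G Q x
= 0`. Then `𝔄` fixes `Q x`, whose lower half is therefore `0`; the equation `H (A* - 1/z) G = Π J`
kills the upper half, contradicting `Q* Q > 0` unless `x = 0`. -/
theorem isUnit_frakA2_mul {r : ℕ} {H : ℕ → Blk p} (h : (blockHankel (r + 1) H).PosDef) {z : ℂ}
    (hz : 0 < z.im) {Q : Col p} (hQ : (Qᴴ * Q).PosDef) (hJ : (Qᴴ * matJ p * Q).PosSemidef) :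
    IsUnit (frakA2 (r + 1) H z * Q).det := by
  have hz0 : z ≠ 0 := by rintro rfl; simp at hz
  rw [← Matrix.isUnit_iff_isUnit_det, ← Matrix.mulVec_injective_iff_isUnit]
  refine (injective_iff_map_eq_zero (Matrix.mulVecLin _)).2 fun x hx => ?_
  rw [Matrix.mulVecLin_apply] at hx
  set G := resolventCol (r + 1) H z with hG
  set S := blockHankel (r + 1) H with hS
  have key := congrArg (fun M => star x ⬝ᵥ M *ᵥ x) (frakA_mul_form h hz0 Q)
  have hc : 0 < 2 * z.im / ‖z‖ ^ 2 := by
    have := norm_pos_iff.2 hz0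
    positivity
  simp only [Matrix.add_mulVec, dotProduct_add, star_dotProduct_conj_mul_mulVec, hx,
    dotProduct_zero, star_zero, zero_dotProduct, add_zero, Matrix.smul_mulVec, dotProduct_smul,
    Matrix.mul_assoc _ (blockHankel _ _)] at key
  rw [← Matrix.mulVec_mulVec x S] at key
  have n1 := hJ.dotProduct_mulVec_nonneg x
  have n2 := h.posSemidef.dotProduct_mulVec_nonneg ((G * Q) *ᵥ x)
  have n3 : (0 : ℂ) ≤ ((2 * z.im / ‖z‖ ^ 2 : ℝ) : ℂ) := by exact_mod_cast hc.le
  have h0 := (add_eq_zero_iff_of_nonneg n1 (smul_nonneg n3 n2)).1 key.symm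
  have hGx : (G * Q) *ᵥ x = 0 := by
    by_contra hne
    have := h.dotProduct_mulVec_pos hne
    rcases smul_eq_zero.1 h0.2 with h' | h'
    · exact hc.ne' (by exact_mod_cast h')
    · exact this.ne' h'
  have hbot : ((colBot p)ᴴ * Q) *ᵥ x = 0 := by
    have e : frakA2 (r + 1) H z * Q = (colBot p)ᴴ * Q +
        (Complex.I • ((colBot p)ᴴ * (matPi (r + 1) H)ᴴ)) * (G * Q) := by
      rw [frakA2, frakA_eq h]
      simp only [Matrix.mul_add, Matrix.add_mul, Matrix.mul_one, Matrix.mul_smul, Matrix.smul_mul,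
        Matrix.mul_assoc]
      rfl
    rwa [e, Matrix.add_mulVec, ← Matrix.mulVec_mulVec x _ (G * Q), hGx, Matrix.mulVec_zero,
      add_zero] at hx
  have htop : ((colTop p)ᴴ * Q) *ᵥ x = 0 := by
    have e : (Phi1 (r + 1) H * ((colBot p)ᴴ * Q) + Phi2 (r + 1) p * ((colTop p)ᴴ * Q)) *ᵥ x = 0 := by
      rw [← Matrix.mul_assoc, ← Matrix.mul_assoc, ← Matrix.add_mul, ← matPi_mul_matJ,
        ← mul_resolventCol h hz0, Matrix.mul_assoc, Matrix.mul_assoc, ← Matrix.mulVec_mulVec,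
        ← Matrix.mulVec_mulVec x _ (_ * Q), hGx, Matrix.mulVec_zero, Matrix.mulVec_zero]
    rw [Matrix.add_mulVec, ← Matrix.mulVec_mulVec, hbot, Matrix.mulVec_zero, zero_add] at e
    have := congrArg (fun v => (Phi2 (r + 1) p)ᴴ *ᵥ v) e
    simpa only [Matrix.mulVec_mulVec, ← Matrix.mul_assoc, Phi2_conj_mul, Matrix.one_mul,
      Matrix.mulVec_zero] using this
  have hQx : Q *ᵥ x = 0 := by
    calc Q *ᵥ x = ((colTop p * (colTop p)ᴴ + colBot p * (colBot p)ᴴ) * Q) *ᵥ x := by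
          rw [colTop_mul_add, Matrix.one_mul]
      _ = 0 := by
          rw [Matrix.add_mul, Matrix.add_mulVec, Matrix.mul_assoc, Matrix.mul_assoc,
            ← Matrix.mulVec_mulVec, ← Matrix.mulVec_mulVec x (colBot p), hbot, htop]
          simp
  by_contra hne
  have := hQ.dotProduct_mulVec_pos hne
  rw [← Matrix.mulVec_mulVec, hQx] at this
  simp at this

/-! ### The matrix inequality and its propagation -/

/-- The functions `g_0 = φ`, `g_{k+1} = z g_k + H_k`. -/
def momentSeq (H : ℕ → Blk p) (z : ℂ) (φ : Blk p) : ℕ → Blk p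
  | 0 => φ
  | k + 1 => z • momentSeq H z φ k + H k

/-- The block column `[g_k; …; g_{k+m-1}]`. -/
def momentCol (m : ℕ) (H : ℕ → Blk p) (z : ℂ) (φ : Blk p) (k : ℕ) :
    Matrix (Fin m × Fin p) (Fin p) ℂ :=
  Matrix.of fun x b => momentSeq H z φ (k + x.1) x.2 b

/-- The `k`-th block column of the identity matrix. -/
def unitCol (m p k : ℕ) : Matrix (Fin m × Fin p) (Fin p) ℂ :=
  Matrix.of fun x b => if (x.1 : ℕ) = k ∧ x.2 = b then 1 else 0

theorem mul_unitCol_apply {m k : ℕ} (hk : k < m) {ι : Type*} (M : Matrix ι (Fin m × Fin p) ℂ)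
    (c : ι) (b : Fin p) : (M * unitCol m p k) c b = M c (⟨k, hk⟩, b) := by
  rw [Matrix.mul_apply, Finset.sum_eq_single (⟨k, hk⟩, b)]
  · simp [unitCol]
  · rintro ⟨i, a⟩ - h
    have : ¬ ((i : ℕ) = k ∧ a = b) := by
      rintro ⟨h1, h2⟩
      exact h (Prod.ext (Fin.ext h1) h2)
    simp [unitCol, this]
  · simp

theorem momentCol_succ {m : ℕ} (H : ℕ → Blk p) (z : ℂ) (φ : Blk p) {k : ℕ} (hk : k < m) :
    momentCol m H z φ (k + 1) = z • momentCol m H z φ k + blockHankel m H * unitCol m p k := by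
  ext x b
  rw [Matrix.add_apply, mul_unitCol_apply hk]
  simp only [momentCol, blockHankel, Matrix.of_apply, Matrix.smul_apply]
  rw [show k + 1 + (x.1 : ℕ) = (k + x.1) + 1 by ring, momentSeq]
  simp [add_comm]

theorem conj_momentCol_mul_unitCol {m : ℕ} (H : ℕ → Blk p) (z : ℂ) (φ : Blk p) (j : ℕ) {k : ℕ}
    (hk : k < m) :
    (momentCol m H z φ j)ᴴ * unitCol m p k = (momentSeq H z φ (j + k))ᴴ := by
  ext a b
  rw [mul_unitCol_apply hk]
  simp [momentCol]

theorem conj_unitCol_mul_blockHankel_mul {m : ℕ} (H : ℕ → Blk p) {k : ℕ} (hk : k < m) :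
    (unitCol m p k)ᴴ * (blockHankel m H * unitCol m p k) = H (2 * k) := by
  ext a b
  have h1 := mul_unitCol_apply hk (blockHankel m H * unitCol m p k)ᴴ b a
  rw [← Matrix.conjTranspose_conjTranspose (unitCol m p k), ← Matrix.conjTranspose_mul,
    Matrix.conjTranspose_apply, Matrix.conjTranspose_apply,
    Matrix.conjTranspose_conjTranspose] at h1
  rw [star_injective h1, mul_unitCol_apply hk]
  simp [blockHankel, two_mul]

/-- The defect `(g_{2k} - g_{2k}*) / i - 2 Im z Y_k* T Y_k` of the fundamental matrix inequality. -/
def defect (m : ℕ) (H : ℕ → Blk p) (z : ℂ) (φ : Blk p) (k : ℕ) : Blk p :=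
  -Complex.I • (momentSeq H z φ (2 * k) - (momentSeq H z φ (2 * k))ᴴ) -
    ((2 * z.im : ℝ) : ℂ) • ((momentCol m H z φ k)ᴴ * matT m H * momentCol m H z φ k)

/-- Pure algebra in an arbitrary `φ`: insert `Y_{k+1} = z Y_k + H E_k`. Since `E* Y_k = g_{2k}` and
`E* H E = H_{2k}`, the cross terms cancel against those of `g_{2k+2}`, and the Hermitian block
`H_{2k+1}` drops out. -/
theorem defect_succ {r : ℕ} {H : ℕ → Blk p} (h : (blockHankel (r + 1) H).PosDef) (z : ℂ) (φ : Blk p)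
    {k : ℕ} (hk : k < r) :
    defect (r + 1) H z φ (k + 1) = ((‖z‖ ^ 2 : ℝ) : ℂ) • defect (r + 1) H z φ k := by
  have e1 : (H (2 * k))ᴴ = H (2 * k) := conjTranspose_of_posDef h (by omega)
  have e2 : (H (2 * k + 1))ᴴ = H (2 * k + 1) := conjTranspose_of_posDef h (by omega)
  set Y := momentCol (r + 1) H z φ k with hY
  set E := unitCol (r + 1) p k with hE
  set S := blockHankel (r + 1) H with hS
  set T := matT (r + 1) H with hT
  set g := momentSeq H z φ (2 * k) with hg
  have hg2 : momentSeq H z φ (2 * (k + 1)) = (z * z) • g + z • H (2 * k) + H (2 * k + 1) := by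
    rw [show 2 * (k + 1) = 2 * k + 1 + 1 by ring, momentSeq, momentSeq, smul_add, smul_smul]
  have hYE : Yᴴ * E = gᴴ := by
    rw [hY, hE, conj_momentCol_mul_unitCol _ _ _ _ (by omega), hg, two_mul]
  have hEY : Eᴴ * Y = g := by
    have := congrArg Matrix.conjTranspose hYE
    simpa using this
  have hESE : Eᴴ * (S * E) = H (2 * k) := conj_unitCol_mul_blockHankel_mul H (by omega)
  have hquad : (momentCol (r + 1) H z φ (k + 1))ᴴ * T * momentCol (r + 1) H z φ (k + 1) =
      (star z * z) • (Yᴴ * T * Y) + star z • gᴴ + z • g + H (2 * k) := by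
    rw [momentCol_succ H z φ (by omega), Matrix.conjTranspose_add, Matrix.conjTranspose_smul,
      Matrix.conjTranspose_mul, h.isHermitian.eq, ← hY, ← hE, ← hS]
    simp only [Matrix.add_mul, Matrix.mul_add, Matrix.smul_mul, Matrix.mul_smul, smul_add,
      smul_smul, Matrix.mul_assoc]
    rw [← Matrix.mul_assoc T S, matT_mul_blockHankel h, Matrix.one_mul, hYE,
      ← Matrix.mul_assoc S T, blockHankel_mul_matT h, Matrix.one_mul, hEY, hESE, mul_comm z]
    abel
  have hn : ((‖z‖ ^ 2 : ℝ) : ℂ) = star z * z := by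
    rw [Complex.star_def, ← Complex.normSq_eq_conj_mul_self, Complex.normSq_eq_norm_sq]
  have him : ((2 * z.im : ℝ) : ℂ) = -Complex.I * (z - star z) := by
    rw [Complex.star_def, Complex.sub_conj]
    push_cast
    linear_combination (2 * (z.im : ℂ)) * Complex.I_sq
  rw [defect, defect, hquad, hg2, hn, him]
  simp only [Matrix.conjTranspose_add, Matrix.conjTranspose_smul, e1, e2]
  rw [← hg]
  ext a b
  simp only [Matrix.sub_apply, Matrix.add_apply, Matrix.smul_apply, smul_eq_mul, star_mul']
  ring

theorem defect_posSemidef {r : ℕ} {H : ℕ → Blk p} (h : (blockHankel (r + 1) H).PosDef) {z : ℂ}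
    {φ : Blk p} (h0 : (defect (r + 1) H z φ 0).PosSemidef) :
    (defect (r + 1) H z φ r).PosSemidef := by
  have : ∀ k ≤ r, (defect (r + 1) H z φ k).PosSemidef := by
    intro k
    induction k with
    | zero => exact fun _ => h0
    | succ k ih =>
      intro hk
      rw [defect_succ h z φ (by omega)]
      have n : (0 : ℂ) ≤ ((‖z‖ ^ 2 : ℝ) : ℂ) := by
        have : (0 : ℝ) ≤ ‖z‖ ^ 2 := by positivity
        exact_mod_cast this
      exact (ih (by omega)).smul n
  exact this r le_rfl

theorem shiftA_sub_mul_momentCol {m : ℕ} (H : ℕ → Blk p) {z : ℂ} (hz : z ≠ 0) (φ : Blk p) :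
    (shiftA m p - z⁻¹ • (1 : BlockMat m p)) * ((Complex.I * z) • momentCol m H z φ 0) =
      Phi1 m H + Phi2 m p * (-Complex.I • φ) := by
  rw [Matrix.sub_mul, Matrix.mul_smul, Matrix.smul_mul, Matrix.one_mul, smul_smul,
    show z⁻¹ * (Complex.I * z) = Complex.I by field_simp]
  ext x b
  rw [Matrix.sub_apply, Matrix.smul_apply, shiftA_mul_apply, Matrix.add_apply, Matrix.smul_apply]
  have e : (Phi2 m p * (-Complex.I • φ)) x b =
      if (x.1 : ℕ) = 0 then -Complex.I * φ x.2 b else 0 := by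
    rw [Matrix.mul_apply]
    split_ifs with hx <;> simp [Phi2, hx]
  rw [e]
  simp only [momentCol, Phi1, Matrix.of_apply, zero_add, smul_eq_mul]
  split_ifs with hx
  · simp [hx, momentSeq]
  · obtain ⟨j, hj⟩ : ∃ j, (x.1 : ℕ) = j + 1 := ⟨x.1 - 1, by omega⟩
    rw [hj, momentSeq]
    simp
    ring

/-- Normalise `ζ = Q (𝔄₂ Q)⁻¹`, so that `𝔄 ζ` has halves `-i φ` and `1`. Then `H G ζ = i z Y_0`, and
the `J`-identity shows that the defect equals `ζ* J ζ`. -/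
theorem lft_defect_posSemidef {r : ℕ} {H : ℕ → Blk p} (h : (blockHankel (r + 1) H).PosDef)
    {Q : ℂ → Col p} (hQ : IsNonsingularPropertyJ Q) {z : ℂ} (hz : 0 < z.im) :
    (defect (r + 1) H z (lft (r + 1) H Q z) 0).PosSemidef := by
  have hz0 : z ≠ 0 := by rintro rfl; simp at hz
  obtain ⟨hQ1, hQ2⟩ := hQ.2 z hz
  have hu := isUnit_frakA2_mul h hz hQ1 hQ2
  set V := frakA2 (r + 1) H z * Q z with hV
  set φ := lft (r + 1) H Q z with hφ
  set ζ := Q z * V⁻¹ with hζ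
  have e2 : frakA2 (r + 1) H z * ζ = 1 := by
    rw [hζ, ← Matrix.mul_assoc, Matrix.mul_nonsing_inv _ hu]
  have e1 : frakA1 (r + 1) H z * ζ = -Complex.I • φ := by
    rw [hφ, lft, smul_smul, hζ, ← Matrix.mul_assoc]; simp [hV]
  have hform := frakA_mul_form h hz0 ζ
  rw [e1, e2] at hform
  set G := resolventCol (r + 1) H z with hG
  set S := blockHankel (r + 1) H with hS
  have hW : S * (G * ζ) = (Complex.I * z) • momentCol (r + 1) H z φ 0 := by
    have h1 : (shiftA (r + 1) p - z⁻¹ • (1 : BlockMat (r + 1) p)) * (S * (G * ζ)) =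
        Phi1 (r + 1) H + Phi2 (r + 1) p * (-Complex.I • φ) := by
      rw [← Matrix.mul_assoc S, ← Matrix.mul_assoc, ← matPi_mul_frakA h hz0, matPi_mul_matJ,
        Matrix.mul_assoc, Matrix.add_mul, ← e1, frakA1, Matrix.mul_assoc, Matrix.mul_assoc,
        Matrix.mul_assoc, ← Matrix.mul_assoc (colBot p)ᴴ]
      have : (colBot p)ᴴ * frakA (r + 1) H z * ζ = 1 := e2
      rw [this, Matrix.mul_one]
    have hu' := isUnit_det_shiftA_sub (r + 1) (p := p) (inv_ne_zero hz0)
    have h2 := h1.trans (shiftA_sub_mul_momentCol H hz0 φ).symm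
    have h3 := congrArg
      (fun M : Matrix (Fin (r + 1) × Fin p) (Fin p) ℂ => (shiftA (r + 1) p - z⁻¹ • (1 : BlockMat (r + 1) p))⁻¹ * M) h2
    simpa only [← Matrix.mul_assoc, Matrix.nonsing_inv_mul _ hu', Matrix.one_mul] using h3
  have hquad : (G * ζ)ᴴ * S * (G * ζ) = ((‖z‖ ^ 2 : ℝ) : ℂ) •
      ((momentCol (r + 1) H z φ 0)ᴴ * matT (r + 1) H * momentCol (r + 1) H z φ 0) := by
    have h1 : (G * ζ)ᴴ * S * (G * ζ) = (S * (G * ζ))ᴴ * matT (r + 1) H * (S * (G * ζ)) := by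
      rw [Matrix.conjTranspose_mul S, h.isHermitian.eq, Matrix.mul_assoc _ S (matT _ _),
        blockHankel_mul_matT h, Matrix.mul_one, Matrix.mul_assoc]
    have hn : ((‖z‖ ^ 2 : ℝ) : ℂ) = star z * z := by
      rw [Complex.star_def, ← Complex.normSq_eq_conj_mul_self, Complex.normSq_eq_norm_sq]
    rw [h1, hW, Matrix.conjTranspose_smul, Matrix.smul_mul, Matrix.smul_mul, Matrix.mul_smul,
      smul_smul, hn]
    congr 1
    simp only [star_mul', Complex.star_def, Complex.conj_I]
    linear_combination (-(starRingEnd ℂ) z * z) * Complex.I_sq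
  have hd : defect (r + 1) H z φ 0 = ζᴴ * matJ p * ζ := by
    rw [hquad, smul_smul] at hform
    have hc : ((2 * z.im / ‖z‖ ^ 2 : ℝ) : ℂ) * ((‖z‖ ^ 2 : ℝ) : ℂ) = ((2 * z.im : ℝ) : ℂ) := by
      rw [← Complex.ofReal_mul, div_mul_cancel₀]
      have := norm_pos_iff.2 hz0
      positivity
    rw [hc] at hform
    rw [defect, ← sub_eq_iff_eq_add.2 hform]
    have hconj : (-Complex.I • φ)ᴴ = Complex.I • φᴴ := by
      rw [Matrix.conjTranspose_smul]; simp
    rw [hconj]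
    simp only [momentSeq, Matrix.conjTranspose_one, Matrix.one_mul, Matrix.mul_one,
      smul_sub, neg_smul]
    abel
  rw [hd, hζ]
  have := hQ2.conjTranspose_mul_mul_same V⁻¹
  simpa only [Matrix.conjTranspose_mul, Matrix.mul_assoc] using this

theorem norm_sq_dotProduct_le {ι : Type*} [Fintype ι] {T : Matrix ι ι ℂ} (hT : T.PosSemidef)
    (a b : ι → ℂ) :
    ‖star a ⬝ᵥ T *ᵥ b‖ ^ 2 ≤ ((star a ⬝ᵥ T *ᵥ a).re + 1) * (star b ⬝ᵥ T *ᵥ b).re := by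
  set c := star a ⬝ᵥ T *ᵥ b with hc
  set s := star a ⬝ᵥ T *ᵥ a with hs
  set q := star b ⬝ᵥ T *ᵥ b with hq
  have hc' : star b ⬝ᵥ T *ᵥ a = star c := by
    rw [hc, ← Matrix.star_dotProduct_star, star_star, Matrix.star_mulVec, hT.isHermitian.eq,
      dotProduct_comm,
      ← Matrix.dotProduct_mulVec, dotProduct_comm]
  have hs0 : 0 ≤ s.re := (Complex.le_def.1 (hT.dotProduct_mulVec_nonneg a)).1
  -- Nearly the minimiser of the form at `b - t a`; the `+ 1` avoids dividing by zero when `a` is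
  -- `T`-null.
  set t : ℂ := ((s.re + 1)⁻¹ : ℝ) * c with ht
  have h := (Complex.le_def.1 (hT.dotProduct_mulVec_nonneg (b - t • a))).1
  have e : star (b - t • a) ⬝ᵥ T *ᵥ (b - t • a) = q - t * star c - star t * c + star t * t * s := by
    simp only [Matrix.mulVec_sub, Matrix.mulVec_smul, star_sub, star_smul, sub_dotProduct,
      dotProduct_sub, smul_dotProduct, dotProduct_smul, smul_eq_mul, hc']
    rw [← hc, ← hs, ← hq]
    ring
  have hn : (starRingEnd ℂ) c * c = ((‖c‖ ^ 2 : ℝ) : ℂ) := by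
    rw [← Complex.normSq_eq_conj_mul_self, Complex.normSq_eq_norm_sq]
  set u : ℝ := (s.re + 1)⁻¹ with hu
  have e2 : q - t * star c - star t * c + star t * t * s =
      q - ((2 * u * ‖c‖ ^ 2 : ℝ) : ℂ) + ((u ^ 2 * ‖c‖ ^ 2 : ℝ) : ℂ) * s := by
    simp only [ht, star_mul', Complex.star_def, Complex.conj_ofReal]
    push_cast at hn ⊢
    linear_combination (-2 * (u : ℂ) + u ^ 2 * s) * hn
  rw [e, e2] at h
  simp only [Complex.zero_re, Complex.add_re, Complex.sub_re, Complex.ofReal_re,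
    Complex.re_ofReal_mul] at h
  have hu1 : u * (s.re + 1) = 1 := inv_mul_cancel₀ (by linarith)
  have hu0 : 0 < u := inv_pos.2 (by linarith)
  have h3 : u * ‖c‖ ^ 2 ≤ q.re := by
    have : u ^ 2 * ‖c‖ ^ 2 * s.re = u * ‖c‖ ^ 2 - u ^ 2 * ‖c‖ ^ 2 := by
      linear_combination (u * ‖c‖ ^ 2) * hu1
    nlinarith [mul_nonneg (sq_nonneg u) (sq_nonneg ‖c‖)]
  calc ‖c‖ ^ 2 = (s.re + 1) * (u * ‖c‖ ^ 2) := by linear_combination (-‖c‖ ^ 2) * hu1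
    _ ≤ _ := mul_le_mul_of_nonneg_left h3 (by linarith)

/-- The scalar function `x* g_{2r} x` is a Nevanlinna function which is small at infinity. -/
theorem momentSeq_bound {r : ℕ} {H : ℕ → Blk p} (h : (blockHankel (r + 1) H).PosDef) {z : ℂ}
    (hz : 0 < z.im) {φ : Blk p} (h0 : (defect (r + 1) H z φ 0).PosSemidef) (x : Fin p → ℂ) :
    0 ≤ (star x ⬝ᵥ H (2 * r) *ᵥ x).re ∧
    0 ≤ (star x ⬝ᵥ momentSeq H z φ (2 * r) *ᵥ x).im ∧
      z.im * ‖star x ⬝ᵥ momentSeq H z φ (2 * r) *ᵥ x‖ ^ 2 ≤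
        ((star x ⬝ᵥ H (2 * r) *ᵥ x).re + 1) *
          (star x ⬝ᵥ momentSeq H z φ (2 * r) *ᵥ x).im := by
  have hT := (matT_posDef h).posSemidef
  have hd := (Complex.le_def.1 ((defect_posSemidef h h0).dotProduct_mulVec_nonneg x)).1
  set g := momentSeq H z φ (2 * r) with hg
  set Y := momentCol (r + 1) H z φ r with hY
  set E := unitCol (r + 1) p r with hE
  set S := blockHankel (r + 1) H with hS
  have hYE : Yᴴ * E = gᴴ := by
    rw [hY, hE, conj_momentCol_mul_unitCol _ _ _ _ (by omega), hg, two_mul]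
  have hEY : Eᴴ * Y = g := by
    have := congrArg Matrix.conjTranspose hYE
    simpa using this
  have hESE : Eᴴ * (S * E) = H (2 * r) := conj_unitCol_mul_blockHankel_mul H (by omega)
  -- In the inner product of `T`, the number `x* g_{2r} x` pairs `H E x` with `Y x`, and `H E x` has
  -- squared length `x* H_{2r} x`. Cauchy–Schwarz then brings in `Y* T Y`, which the defect
  -- controls.
  have i1 : star x ⬝ᵥ g *ᵥ x = star ((S * E) *ᵥ x) ⬝ᵥ matT (r + 1) H *ᵥ (Y *ᵥ x) := by
    rw [Matrix.mulVec_mulVec, ← star_dotProduct_conj_mul_mulVec,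
      Matrix.conjTranspose_mul, h.isHermitian.eq, Matrix.mul_assoc, ← Matrix.mul_assoc S,
      blockHankel_mul_matT h, Matrix.one_mul, hEY]
  have i2 : star x ⬝ᵥ H (2 * r) *ᵥ x =
      star ((S * E) *ᵥ x) ⬝ᵥ matT (r + 1) H *ᵥ ((S * E) *ᵥ x) := by
    rw [Matrix.mulVec_mulVec, ← star_dotProduct_conj_mul_mulVec,
      Matrix.conjTranspose_mul, h.isHermitian.eq, Matrix.mul_assoc, ← Matrix.mul_assoc S,
      blockHankel_mul_matT h, Matrix.one_mul, hESE]
  have hcs := norm_sq_dotProduct_le hT ((S * E) *ᵥ x) (Y *ᵥ x)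
  rw [← i1, ← i2] at hcs
  have hs0 := (Complex.le_def.1 (hT.dotProduct_mulVec_nonneg ((S * E) *ᵥ x))).1
  rw [← i2] at hs0
  have hq0 := (Complex.le_def.1 (hT.dotProduct_mulVec_nonneg (Y *ᵥ x))).1
  set q := star (Y *ᵥ x) ⬝ᵥ matT (r + 1) H *ᵥ (Y *ᵥ x) with hq
  have e : star x ⬝ᵥ (defect (r + 1) H z φ r) *ᵥ x =
      -Complex.I * (star x ⬝ᵥ g *ᵥ x - star (star x ⬝ᵥ g *ᵥ x)) - ((2 * z.im : ℝ) : ℂ) * q := by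
    have e3 : star x ⬝ᵥ gᴴ *ᵥ x = star (star x ⬝ᵥ g *ᵥ x) := by
      rw [← Matrix.star_dotProduct_star, star_star, Matrix.star_mulVec, dotProduct_comm,
        ← Matrix.dotProduct_mulVec, dotProduct_comm]
    rw [hq, Matrix.mulVec_mulVec, ← star_dotProduct_conj_mul_mulVec, ← e3, defect]
    simp only [Matrix.sub_mulVec, Matrix.smul_mulVec, dotProduct_sub, dotProduct_smul, smul_eq_mul,
      Matrix.mul_assoc]
    rfl
  rw [e] at hd
  have e4 : (-Complex.I * (star x ⬝ᵥ g *ᵥ x - star (star x ⬝ᵥ g *ᵥ x)) -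
      ((2 * z.im : ℝ) : ℂ) * q).re = 2 * (star x ⬝ᵥ g *ᵥ x).im - 2 * z.im * q.re := by
    rw [Complex.sub_re, Complex.re_ofReal_mul]
    simp
    ring
  rw [e4] at hd
  simp only [Complex.zero_re] at hd hs0 hq0
  have h5 : z.im * q.re ≤ (star x ⬝ᵥ g *ᵥ x).im := by linarith
  refine ⟨hs0, le_trans (by positivity) h5, ?_⟩
  calc _ ≤ z.im * (((star x ⬝ᵥ H (2 * r) *ᵥ x).re + 1) * q.re) := by gcongr
    _ = ((star x ⬝ᵥ H (2 * r) *ᵥ x).re + 1) * (z.im * q.re) := by ring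
    _ ≤ _ := by gcongr

/-! ### Holomorphy of `φ` -/

section Holomorphic

variable {s : Set ℂ} {k l q : Type*} [Fintype l]

theorem differentiableOn_matrix_mul {A : ℂ → Matrix k l ℂ} {B : ℂ → Matrix l q ℂ}
    (hA : ∀ i j, DifferentiableOn ℂ (fun z => A z i j) s)
    (hB : ∀ i j, DifferentiableOn ℂ (fun z => B z i j) s) (i : k) (j : q) :
    DifferentiableOn ℂ (fun z => (A z * B z) i j) s := by
  simp only [Matrix.mul_apply]
  exact DifferentiableOn.fun_sum fun a _ => (hA i a).mul (hB a j)

theorem differentiableOn_det [DecidableEq l] {A : ℂ → Matrix l l ℂ}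
    (hA : ∀ i j, DifferentiableOn ℂ (fun z => A z i j) s) :
    DifferentiableOn ℂ (fun z => (A z).det) s := by
  simp only [Matrix.det_apply]
  exact DifferentiableOn.fun_sum fun σ _ =>
    (DifferentiableOn.fun_finsetProd fun i _ => hA (σ i) i).const_smul _

theorem differentiableOn_matrix_inv [DecidableEq l] {A : ℂ → Matrix l l ℂ}
    (hA : ∀ i j, DifferentiableOn ℂ (fun z => A z i j) s) (hu : ∀ z ∈ s, IsUnit (A z).det)
    (i j : l) : DifferentiableOn ℂ (fun z => (A z)⁻¹ i j) s := by
  simp only [Matrix.inv_def, Matrix.smul_apply, Matrix.adjugate_apply, smul_eq_mul,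
    Ring.inverse_eq_inv']
  refine ((differentiableOn_det hA).inv fun z hz => (hu z hz).ne_zero).mul
    (differentiableOn_det fun a b => ?_)
  by_cases h : a = j
  · subst h
    simp only [Matrix.updateRow_self]
    exact differentiableOn_const _
  · simp only [Matrix.updateRow_ne h]
    exact hA a b

end Holomorphic

/-- The substitution `1 / z̄` followed by the adjoint turns each factor into `1 - i z (J Q_k)*`, so
the product is a polynomial in `z`. -/
theorem differentiableOn_conj_canonicalProduct (ω : ℕ → Row p) (m : ℕ) (s : Set ℂ) :
    ∀ i j, DifferentiableOn ℂ
      (fun z => (canonicalProduct ω m (1 / (starRingEnd ℂ) z))ᴴ i j) s := by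
  induction m with
  | zero =>
    intro i j
    simp only [canonicalProduct]
    exact differentiableOn_const _
  | succ m ih =>
    have e : ∀ z, (canonicalProduct ω (m + 1) (1 / (starRingEnd ℂ) z))ᴴ =
        (canonicalProduct ω m (1 / (starRingEnd ℂ) z))ᴴ *
          (1 + (-Complex.I * z) • (matJ p * hamiltonian ω m)ᴴ) := by
      intro z
      rw [canonicalProduct, Matrix.conjTranspose_mul, Matrix.conjTranspose_add,
        Matrix.conjTranspose_smul, Matrix.conjTranspose_one]
      simp
    intro i j
    simp only [e]
    refine differentiableOn_matrix_mul ih (fun a b => ?_) i j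
    simp only [Matrix.add_apply, Matrix.smul_apply, smul_eq_mul]
    fun_prop

theorem differentiableOn_frakA {m : ℕ} {H : ℕ → Blk p} (h : (blockHankel m H).PosDef) (i j) :
    DifferentiableOn ℂ (fun z => frakA m H z i j) {z | 0 < z.im} := by
  refine (differentiableOn_conj_canonicalProduct (verblunsky H) m _ i j).congr fun z hz => ?_
  have hz0 : z ≠ 0 := by rintro rfl; simp at hz
  rw [frakA, transfer_eq_canonicalProduct h (by simpa using hz0)]

theorem differentiableOn_lft {r : ℕ} {H : ℕ → Blk p} (h : (blockHankel (r + 1) H).PosDef)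
    {Q : ℂ → Col p} (hQ : IsNonsingularPropertyJ Q) (i j) :
    DifferentiableOn ℂ (fun z => lft (r + 1) H Q z i j) {z | 0 < z.im} := by
  have hA := differentiableOn_frakA h
  have hC : ∀ (C : Row p) i j, DifferentiableOn ℂ
      (fun z => (C * frakA (r + 1) H z * Q z) i j) {z | 0 < z.im} := fun C =>
    differentiableOn_matrix_mul (differentiableOn_matrix_mul
      (fun _ _ => differentiableOn_const _) hA) hQ.1
  have hV := differentiableOn_matrix_inv (hC (colBot p)ᴴ) fun z hz =>
    isUnit_frakA2_mul h hz (hQ.2 z hz).1 (hQ.2 z hz).2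
  exact (differentiableOn_matrix_mul (hC (colTop p)ᴴ) hV i j).const_mul Complex.I

theorem momentSeq_eq (H : ℕ → Blk p) {z : ℂ} (hz : z ≠ 0) (φ : Blk p) (k : ℕ) :
    momentSeq H z φ k = z ^ k • (φ + ∑ j ∈ Finset.range k, (z ^ (j + 1))⁻¹ • H j) := by
  induction k with
  | zero => simp [momentSeq]
  | succ k ih =>
    rw [momentSeq, ih, Finset.sum_range_succ, ← add_assoc, smul_add (z ^ (k + 1)),
      smul_smul, smul_smul (z ^ (k + 1)), mul_inv_cancel₀ (pow_ne_zero _ hz), one_smul, pow_succ']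

theorem differentiableOn_momentSeq {H : ℕ → Blk p} {φ : ℂ → Blk p} {s : Set ℂ}
    (hφ : ∀ i j, DifferentiableOn ℂ (fun z => φ z i j) s) (k : ℕ) :
    ∀ i j, DifferentiableOn ℂ (fun z => momentSeq H z (φ z) k i j) s := by
  induction k with
  | zero => exact hφ
  | succ k ih =>
    intro i j
    simp only [momentSeq, Matrix.add_apply, Matrix.smul_apply, smul_eq_mul]
    exact (differentiableOn_id.mul (ih i j)).add_const _

theorem differentiableOn_form {G : ℂ → Blk p} {s : Set ℂ}
    (hG : ∀ i j, DifferentiableOn ℂ (fun z => G z i j) s) (x : Fin p → ℂ) :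
    DifferentiableOn ℂ (fun z => star x ⬝ᵥ G z *ᵥ x) s := by
  simp only [dotProduct, Matrix.mulVec]
  exact DifferentiableOn.fun_sum fun i _ => (DifferentiableOn.fun_sum fun j _ =>
    (hG i j).mul_const _).const_mul _

/-- Polarisation. -/
theorem apply_eq_form (G : Blk p) (a b : Fin p) :
    G a b = 2⁻¹ * ((star (Pi.single a 1 + Pi.single b 1 : Fin p → ℂ) ⬝ᵥ
        G *ᵥ (Pi.single a 1 + Pi.single b 1) -
        Complex.I * (star (Pi.single a 1 + Pi.single b Complex.I : Fin p → ℂ) ⬝ᵥ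
        G *ᵥ (Pi.single a 1 + Pi.single b Complex.I))) - (1 - Complex.I) *
        ((star (Pi.single a 1 : Fin p → ℂ) ⬝ᵥ G *ᵥ Pi.single a 1) +
          (star (Pi.single b 1 : Fin p → ℂ) ⬝ᵥ G *ᵥ Pi.single b 1))) := by
  have hs : ∀ (c : Fin p) (t : ℂ), star (Pi.single c t : Fin p → ℂ) = Pi.single c (star t) := by
    intro c t
    ext i
    by_cases h : i = c <;> simp [h]
  simp only [star_add, hs, Matrix.mulVec_add, add_dotProduct, dotProduct_add, single_dotProduct,
    Matrix.mulVec_single, Pi.smul_apply, Matrix.col_apply, MulOpposite.smul_eq_mul_unop,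
    MulOpposite.unop_op, star_one, Complex.star_def, Complex.conj_I]
  linear_combination (1 / 2 * G a b - 1 / 2 * G b a - 1 / 2 * Complex.I * G b b) * Complex.I_sq

/-! ### The asymptotic expansion -/

theorem exists_expansion {r : ℕ} {H : ℕ → Blk p} (h : (blockHankel (r + 1) H).PosDef)
    {Q : ℂ → Col p} (hQ : IsNonsingularPropertyJ Q) :
    ∃ c : ℕ → Blk p, (∀ k < 2 * r, c k = -H k) ∧
      HasNontangentialExpansion (lft (r + 1) H Q) (2 * r + 1) c := by
  set G : ℂ → Blk p := fun z => momentSeq H z (lft (r + 1) H Q z) (2 * r) with hG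
  have hform : ∀ x : Fin p → ℂ, ∃ c : ℂ, ∀ δ : ℝ, 0 < δ →
      Filter.Tendsto (fun z => z * (star x ⬝ᵥ G z *ᵥ x)) (sectorAtInfinity δ) (nhds c) := by
    intro x
    have hb := fun (z : ℂ) (hz : 0 < z.im) =>
      momentSeq_bound h hz (lft_defect_posSemidef h hQ hz) x
    have hs := (hb Complex.I (by simp)).1
    exact exists_tendsto_mul
      (differentiableOn_form (differentiableOn_momentSeq (differentiableOn_lft h hQ) _) x)
      (s := (star x ⬝ᵥ H (2 * r) *ᵥ x).re + 1) (by linarith) (fun z hz => (hb z hz).2.1)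
      fun z hz => (hb z hz).2.2
  choose f hf using hform
  have hent : ∀ a b : Fin p, ∃ c : ℂ, ∀ δ : ℝ, 0 < δ →
      Filter.Tendsto (fun z => z * G z a b) (sectorAtInfinity δ) (nhds c) := by
    intro a b
    refine ⟨2⁻¹ * (f (Pi.single a 1 + Pi.single b 1) -
      Complex.I * f (Pi.single a 1 + Pi.single b Complex.I) -
        (1 - Complex.I) * (f (Pi.single a 1) + f (Pi.single b 1))), fun δ hδ => ?_⟩
    have := (((hf (Pi.single a 1 + Pi.single b 1) δ hδ).sub
      ((hf (Pi.single a 1 + Pi.single b Complex.I) δ hδ).const_mul Complex.I)).sub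
      (((hf (Pi.single a 1) δ hδ).add (hf (Pi.single b 1) δ hδ)).const_mul
        (1 - Complex.I))).const_mul 2⁻¹
    refine this.congr fun z => ?_
    rw [apply_eq_form (G z) a b]
    ring
  choose C hC using hent
  -- The second branch enters the sum only at `k = 2r`; `C` is the limit of `z g_{2r}`.
  refine ⟨fun k => if k < 2 * r then -H k else Matrix.of C, fun k hk => if_pos hk,
    fun δ hδ a b => ?_⟩
  have h0 : (fun z => z * G z a b - C a b) =o[sectorAtInfinity δ] fun _ => (1 : ℂ) := by
    rw [Asymptotics.isLittleO_one_iff]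
    simpa using (hC a b δ hδ).sub_const (C a b)
  have h1 := (Asymptotics.isBigO_refl (fun z : ℂ => (z ^ (2 * r + 1))⁻¹)
    (sectorAtInfinity δ)).mul_isLittleO h0
  simp only [mul_one] at h1
  refine h1.congr' ?_ Filter.EventuallyEq.rfl
  filter_upwards [eventually_sector δ 0] with z hz
  have hz0 : z ≠ 0 := norm_pos_iff.1 hz.1
  have hsum : ∑ k ∈ Finset.range (2 * r), (z ^ (k + 1))⁻¹ *
      (if k < 2 * r then -H k else Matrix.of C) a b =
      -∑ k ∈ Finset.range (2 * r), (z ^ (k + 1))⁻¹ * H k a b := by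
    rw [← Finset.sum_neg_distrib]
    refine Finset.sum_congr rfl fun k hk => ?_
    rw [if_pos (Finset.mem_range.1 hk), Matrix.neg_apply, mul_neg]
  rw [Finset.sum_range_succ, hsum, if_neg (lt_irrefl _), Matrix.of_apply]
  simp only [hG]
  rw [momentSeq_eq H hz0, Matrix.smul_apply, Matrix.add_apply, Matrix.sum_apply]
  simp only [Matrix.smul_apply, smul_eq_mul, pow_succ z (2 * r)]
  field_simp
  ring

theorem eq_neg_of_expansion {r : ℕ} (hr : 0 < r) {H : ℕ → Blk p}
    (h : (blockHankel (r + 1) H).PosDef) {Q : ℂ → Col p} (hQ : IsNonsingularPropertyJ Q)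
    {c : ℕ → Blk p} (hc : HasNontangentialExpansion (lft (r + 1) H Q) (2 * r + 1) c) :
    c (2 * r - 1) = -H (2 * r - 1) := by
  obtain ⟨c', hc', he⟩ := exists_expansion h hQ
  rw [hc.unique he _ (by omega), hc' _ (by omega)]

end HankelVerblunsky

end

/-! ### Assembly -/

open HankelVerblunsky in
theorem mainTheorem1 (p n : ℕ) (hn : 1 ≤ n) :
    Set.BijOn
      (fun (M : BlockMat n p) (k : Fin n) => verblunsky (hankelBlock M) (k : ℕ))
      (posDefHankel n p) {ω : Fin n → Row p | IsAdmissible ω} ∧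
    ∀ M ∈ posDefHankel n p, ∀ H : ℕ → Blk p, H = hankelBlock M →
      ∀ ω : ℕ → Row p, ω = verblunsky H →
        H 0 = (ω 0 * colBot p)⁻¹ ∧
        ∀ r : ℕ, 0 < r → r < n →
          (∀ z : ℂ, z ≠ 0 → transfer (r + 1) H z = canonicalProduct ω (r + 1) z) ∧
          (∀ Q : ℂ → Col p, IsNonsingularPropertyJ Q →
            (∀ z : ℂ, 0 < z.im → IsUnit (frakA2 (r + 1) H z * Q z).det) ∧
            (∃ c : ℕ → Blk p, (∀ k < 2 * r, c k = -H k) ∧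
              HasNontangentialExpansion (lft (r + 1) H Q) (2 * r + 1) c) ∧
            (∀ c : ℕ → Blk p, HasNontangentialExpansion (lft (r + 1) H Q) (2 * r + 1) c →
              c (2 * r - 1) = -H (2 * r - 1))) ∧
          H (2 * r) = (Complex.I • (ω r * matJ p * (ω (r - 1))ᴴ))⁻¹ +
            (calH12 r H)ᴴ * matT r H * calH12 r H := by
  refine ⟨bijOn_verblunsky p n, ?_⟩
  rintro M ⟨hM, hpos⟩ H rfl ω rfl
  rw [← blockHankel_hankelBlock hM] at hpos
  refine ⟨?_, fun r hr hrn => ?_⟩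
  · have h1 := blockHankel_posDef_mono hn hpos
    rw [verblunsky_zero_colBot, inv_lastBlk h1]
    -- For `r = 0` the correction in the Schur complement is an empty sum.
    ext i j
    simp [Matrix.mul_apply]
  have h := blockHankel_posDef_mono (show r + 1 ≤ n from hrn) hpos
  refine ⟨fun z hz => transfer_eq_canonicalProduct h hz, fun Q hQ =>
    ⟨fun z hz => isUnit_frakA2_mul h hz (hQ.2 z hz).1 (hQ.2 z hz).2, exists_expansion h hQ,
      fun c hc => eq_neg_of_expansion hr h hQ hc⟩, ?_⟩
  obtain ⟨l, rfl⟩ : ∃ l, r = l + 1 := ⟨r - 1, by omega⟩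
  rw [Nat.add_sub_cancel, verblunsky_mul_conj_pred h]
  exact eq_schur h
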